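/- Let $R$ be an integral domain, not a field, with quotient field $K$, and let $R^{*}=\{x\in K : \text{there is } 0\ne r\in R \text{ with } rx^{n}\in R \text{ for all } n\ge 0\}$ be its complete integral closure. For $R$-submodules $I,J$ of $K$ write $I:J=\{x\in K: xJ\subseteq I\}$. Assume that $R$ is a Mori domain, i.e. that $R$ satisfies the ascending chain condition on divisorial ideals (the nonzero ideals $I$ of $R$ with $R:(R:I)=I$), and that $R:R^{*}\neq(0)$. Then the following are equivalent. 1. $R$ is an FAF-domain. 2. $R_{M}$ is an FAF-domain for each maximal ideal $M$ of $R$. 3. $R$ and $R^{*}$ both have Krull dimension $1$, and the extension $R\subseteq R^{*}$ is unibranched: for each prime ideal $P$ of $R$ there is exactly one prime ideal $Q$ of $R^{*}$ with $Q\cap R=P$. 4. $R$ is locally conducive: for each maximal ideal $M$ of $R$, every ring $T$ with $R_{M}\subseteq T\subsetneq K$ is a fractional ideal of $R_{M}$, i.e. $sT\subseteq R_{M}$ for some nonzero $s\in R_{M}$. Here an ideal $I$ of a ring $A$ is $n$-absorbing if, whenever $a_{1},\dots,a_{n+1}\in A$ and $a_{1}\cdots a_{n+1}\in I$, there is an $i$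 with $\prod_{j\ne i}a_{j}\in I$; and an FAF-domain is an integral domain $A$ of finite AF-dimension, i.e. one for which there is a positive integer $n$ such that every proper ideal of $A$ is a finite product of $n$-absorbing ideals of $A$. -/

import Mathlib

/-- `I` is an `n`-absorbing ideal: whenever a product of `n + 1` elements lies in `I`, one of the
`n + 1` subproducts with a single factor left out already lies in `I`. -/
def IsNAbsorbing {R : Type*} [CommRing R] (n : ℕ) (I : Ideal R) : Prop :=
  ∀ a : Fin (n + 1) → R, ∏ i, a i ∈ I →
    ∃ i, ∏ j ∈ Finset.univ.erase i, a j ∈ I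

/-- Every proper ideal of `R` is a finite product of `n`-absorbing ideals. -/
def HasAbsorbingFactorization (R : Type*) [CommRing R] (n : ℕ) : Prop :=
  ∀ I : Ideal R, I ≠ ⊤ →
    ∃ s : Multiset (Ideal R), (∀ J ∈ s, IsNAbsorbing n J) ∧ s.prod = I

/-- The AF-dimension: the least positive integer `n` such that every proper ideal of `R` is a
finite product of `n`-absorbing ideals, and `⊤` if there is no such `n`. -/
noncomputable def afDim (R : Type*) [CommRing R] : ℕ∞ :=
  sInf {d : ℕ∞ | ∃ n : ℕ, 0 < n ∧ HasAbsorbingFactorization R n ∧ d = n}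

/-- An FAF-domain is an integral domain of finite AF-dimension. -/
def IsFAFDomain (R : Type*) [CommRing R] : Prop :=
  IsDomain R ∧ afDim R < ⊤

/-- For `R`-submodules `I`, `J` of `K`, the quotient `I / J` of submodules is `{x | x J ⊆ I}`;
in particular `1 / J` is `R : J`, since `1 : Submodule R K` is the image of `R` in `K`.
A nonzero ideal `I` of a domain `R` with quotient field `K` is divisorial if `R : (R : I) = I`. -/
def IsDivisorialIdeal {R : Type*} (K : Type*) [CommRing R] [Field K] [Algebra R K]
    (I : Ideal R) : Prop :=
  I ≠ ⊥ ∧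
    (1 : Submodule R K) / ((1 : Submodule R K) / IsLocalization.coeSubmodule K I) =
      IsLocalization.coeSubmodule K I

/-- A domain `R` with quotient field `K` is a Mori domain if it satisfies the ascending chain
condition on divisorial ideals. -/
def IsMoriDomain (R K : Type*) [CommRing R] [IsDomain R] [Field K] [Algebra R K]
    [IsFractionRing R K] : Prop :=
  WellFoundedGT {I : Ideal R // IsDivisorialIdeal K I}

/-- A domain `R` is conducive if each overring of `R` (a ring between `R` and its quotient field)
other than the quotient field is a fractional ideal of `R`. -/
def IsConducive (R : Type*) [CommRing R] [IsDomain R] : Prop :=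
  ∀ T : Subalgebra R (FractionRing R), T ≠ ⊤ →
    IsFractional (nonZeroDivisors R) (Subalgebra.toSubmodule T)

/-- A domain `R` is locally conducive if `R_M` is conducive for each maximal ideal `M`. -/
def IsLocallyConducive (R : Type*) [CommRing R] [IsDomain R] : Prop :=
  ∀ (M : Ideal R) [M.IsMaximal], IsConducive (Localization.AtPrime M)

/-- The ring extension `R ⊆ T` is unibranched: over each prime ideal of `R` there lies exactly
one prime ideal of `T`. -/
def IsUnibranched (R T : Type*) [CommRing R] [CommRing T] [Algebra R T] : Prop :=
  ∀ P : Ideal R, P.IsPrime → ∃! Q : Ideal T, Q.IsPrime ∧ Q.comap (algebraMap R T) = P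

/-! Write `B` for the complete integral closure. The four conditions all say the same thing: for
every maximal ideal `M` of `R`, the localization `B_M` of `B` at `R \ M` is a discrete valuation
ring.

Fractional ideals are replaced by divisibility. Mori gives the chain condition `ColonACC`, and the
nonzero conductor makes `B` completely integrally closed (`PowDvdClosed`); both properties hold for
`B` and for its localizations. For such a ring, `isDiscreteValuationRing_of_colon` reduces
everything to one colon prime `p = xB : z`: if all elements outside `p` are units, then
multiplication by `z/x` takes some `m ∈ p` to a unit, so `m` generates `p`.

It remains to find units outside `p` in `B_M`. If `R` is one-dimensional and the extension
unibranched, `p` and any maximal ideal contract to the same prime of `B`. If `R_M` is conducive, the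
localization of `B_M` at `p` is a fractional ideal, so the powers of `1/f` with `f ∉ p` have a
common denominator. If `R_M` is FAF, the key remark is that an ideal with no proper factorization is
itself `n`-absorbing. This applies to `(x, y)` with `y` regular modulo `x` (`irreducible_span_pair`)
and to proper ideals containing an element outside the square of the maximal ideal. With the theorem
that `J.radical ^ n ≤ J` for `n`-absorbing `J` (`IsNAbsorbing.radical_pow_le`), it yields a nonunit
`t ≠ 0` such that `tR_M` contains the `n`-th power of the maximal ideal, then dimension one.
Counting the factors of principal ideals now bounds the powers of elements outside `p`.

Conversely, let `B_M` be a discrete valuation ring. Proper overrings of `R_M` lie in `B_M`, and an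
ideal of `R_M` of large value is `t` times another, so only ideals containing a fixed power of the
maximal ideal remain; these are absorbing (`HasConductor.exists_factorization`). Contraction to `R`
and finiteness of the set of maximal ideals over a nonzero element glue the local factorizations. -/

/-- The ideal of all `r` with `x ∣ r * z` for every `z ∈ Z`, i.e. the colon ideal `xA : Z`. For
`x ≠ 0` these are the divisorial ideals of `A` containing `x`. -/
def dvdColon {A : Type*} [CommRing A] (x : A) (Z : Set A) : Ideal A where
  carrier := {r | ∀ z ∈ Z, x ∣ r * z}
  add_mem' ha hb z hz := by rw [add_mul]; exact dvd_add (ha z hz) (hb z hz)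
  zero_mem' z _ := by simp
  smul_mem' c r hr z hz := by rw [smul_eq_mul, mul_assoc]; exact (hr z hz).mul_left c

/-- The ascending chain condition on the ideals `xA : Z`, for each `x ≠ 0`. -/
def ColonACC (A : Type*) [CommRing A] : Prop :=
  ∀ x : A, x ≠ 0 → WellFoundedGT (Set.range (dvdColon x))

/-- A divisibility form of being completely integrally closed: if `d (b/a)ⁿ` lies in `B` for all
`n`, then so does `b/a`. -/
def PowDvdClosed (B : Type*) [CommRing B] : Prop :=
  ∀ a b d : B, d ≠ 0 → (∀ n : ℕ, a ^ n ∣ d * b ^ n) → a ∣ b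

/-- An injective ring extension `A → B` with `cB ⊆ A` for some `c ≠ 0` in `A`. -/
structure HasConductor (A B : Type*) [CommRing A] [CommRing B] [Algebra A B] : Prop where
  inj : Function.Injective (algebraMap A B)
  exists_conductor : ∃ c : A, c ≠ 0 ∧ ∀ b : B, ∃ a : A, algebraMap A B a = algebraMap A B c * b

/-! ### Colon ideals, and a criterion for discrete valuation rings -/

section Colon

variable {A : Type*} [CommRing A]

theorem mem_dvdColon {x r : A} {Z : Set A} : r ∈ dvdColon x Z ↔ ∀ z ∈ Z, x ∣ r * z := Iff.rfl

theorem mem_dvdColon_singleton {x r z : A} : r ∈ dvdColon x {z} ↔ x ∣ r * z := by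
  simp [mem_dvdColon]

theorem self_mem_dvdColon (x : A) (Z : Set A) : x ∈ dvdColon x Z := fun z _ => dvd_mul_right x z

theorem dvdColon_anti (x : A) {Z W : Set A} (h : Z ⊆ W) : dvdColon x W ≤ dvdColon x Z :=
  fun _ hr z hz => hr z (h hz)

theorem dvdColon_triple (x : A) (Z : Set A) :
    dvdColon x (dvdColon x (dvdColon x Z) : Set A) = dvdColon x Z := by
  apply le_antisymm
  · intro r hr z hz
    refine hr z fun w hw => ?_
    rw [mul_comm]
    exact hw z hz
  · intro r hr z hz
    rw [mul_comm]
    exact hz r hr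

theorem ColonACC.exists_maximal (h : ColonACC A) {x : A} (hx : x ≠ 0) {ι : Type*} [Nonempty ι]
    (f : ι → Set A) :
    ∃ i, ∀ j, dvdColon x (f i) ≤ dvdColon x (f j) → dvdColon x (f j) ≤ dvdColon x (f i) := by
  have := h x hx
  let g : ι → Set.range (dvdColon x) := fun i => ⟨dvdColon x (f i), f i, rfl⟩
  obtain ⟨_, ⟨i, rfl⟩, hi⟩ := (wellFounded_gt (α := Set.range (dvdColon x))).has_min
    (Set.range g) (Set.range_nonempty g)
  refine ⟨i, fun j hij => ?_⟩
  by_contra hji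
  exact hi (g j) ⟨j, rfl⟩ (lt_of_le_not_ge hij hji)

/-- If all `t ^ l` divide `x`, the chain `xA : t ^ n` becomes stationary, and the cofactor of `t ^
(n + 1)` in `x` then yields an inverse of `t`. -/
theorem ColonACC.exists_not_pow_dvd [IsDomain A] (h : ColonACC A) {x t : A} (hx : x ≠ 0)
    (ht : ¬ IsUnit t) : ∃ l : ℕ, ¬ t ^ l ∣ x := by
  by_contra! hcon
  choose b hb using hcon
  obtain ⟨n, hn⟩ := h.exists_maximal hx (fun n : ℕ => {t ^ n})
  have hle : dvdColon x {t ^ n} ≤ dvdColon x {t ^ (n + 1)} := fun r hr => by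
    rw [mem_dvdColon_singleton] at hr ⊢
    rw [pow_succ, ← mul_assoc]
    exact hr.mul_right t
  have hmem : b (n + 1) ∈ dvdColon x {t ^ (n + 1)} := by
    rw [mem_dvdColon_singleton, mul_comm, ← hb]
  obtain ⟨f, hf⟩ := mem_dvdColon_singleton.1 (hn _ hle hmem)
  apply ht
  have h1 : x * (f * t) = x * 1 := by
    rw [← mul_assoc, ← hf, mul_one]
    conv_rhs => rw [hb (n + 1)]
    ring
  exact IsUnit.of_mul_eq_one_right f (mul_left_cancel₀ hx h1)

/-- The usual argument for associated primes: a colon `xA : z` that is maximal among those with `z`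
a multiple of `w` is prime. -/
theorem exists_prime_colon (h : ColonACC A) {x w : A} (hx : x ≠ 0) (hw : ¬ x ∣ w) :
    ∃ z, ¬ x ∣ z ∧ w ∣ z ∧ (dvdColon x {z}).IsPrime := by
  let ι := {z : A // ¬ x ∣ z ∧ w ∣ z}
  have : Nonempty ι := ⟨⟨w, hw, dvd_rfl⟩⟩
  obtain ⟨⟨z, hz, hwz⟩, hmax⟩ := h.exists_maximal hx (fun i : ι => {i.1})
  refine ⟨z, hz, hwz, ?_⟩
  rw [Ideal.isPrime_iff]
  constructor
  · rw [Ne, Ideal.eq_top_iff_one, mem_dvdColon_singleton, one_mul]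
    exact hz
  · intro a b hab
    by_contra! hcon
    rw [mem_dvdColon_singleton] at hab
    rw [mem_dvdColon_singleton, mem_dvdColon_singleton] at hcon
    have := hmax ⟨a * z, hcon.1, hwz.mul_left a⟩ (fun r hr => by
      rw [mem_dvdColon_singleton] at hr ⊢
      rw [mul_left_comm]; exact hr.mul_left a)
    refine hcon.2 (mem_dvdColon_singleton.1 (this (mem_dvdColon_singleton.2 ?_)))
    rw [← mul_assoc, mul_comm b a]; exact hab

/-- Otherwise `z/x` maps the ideal `xA : z` into itself; then `x (z/x)ⁿ` stays in `A`, so `z/x` is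
almost integral and lies in `A`. -/
theorem PowDvdClosed.exists_not_mem [IsDomain A] (hc : PowDvdClosed A) {x z : A} (hx : x ≠ 0)
    (hz : ¬ x ∣ z) : ∃ m ∈ dvdColon x {z}, ∃ e ∉ dvdColon x {z}, m * z = x * e := by
  by_contra! hcon
  apply hz
  refine hc x z x hx fun n => ?_
  suffices ∃ e ∈ dvdColon x {z}, x * z ^ n = x ^ n * e by
    obtain ⟨e, -, he⟩ := this
    exact ⟨e, he⟩
  induction n with
  | zero => exact ⟨x, self_mem_dvdColon _ _, by simp⟩
  | succ n ih =>
    obtain ⟨e, he, h1⟩ := ih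
    obtain ⟨e', he'⟩ := mem_dvdColon_singleton.1 he
    refine ⟨e', ?_, ?_⟩
    · by_contra h2
      exact hcon e he e' h2 he'
    · rw [pow_succ, ← mul_assoc, h1, mul_assoc, he', pow_succ, mul_assoc]

/-- For prime `p` this says that `d` is not divisible by all powers of `m` in the localization at
`p`, stated without localizing. -/
theorem ColonACC.exists_forall_not_pow_dvd [IsDomain A] (h : ColonACC A) {p : Ideal A} {m d : A}
    (hm : m ∈ p) (hd : d ≠ 0) : ∃ l : ℕ, ∀ f ∉ p, ¬ m ^ l ∣ d * f := by
  by_contra! hcon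
  choose f hf b hb using hcon
  obtain ⟨n, hn⟩ := h.exists_maximal hd (fun n : ℕ => {m ^ n})
  have hle : dvdColon d {m ^ n} ≤ dvdColon d {m ^ (n + 1)} := fun r hr => by
    rw [mem_dvdColon_singleton] at hr ⊢
    rw [pow_succ, ← mul_assoc]
    exact hr.mul_right m
  have hmem : b (n + 1) ∈ dvdColon d {m ^ (n + 1)} := by
    rw [mem_dvdColon_singleton, mul_comm, ← hb]
    exact dvd_mul_right _ _
  obtain ⟨g, hg⟩ := mem_dvdColon_singleton.1 (hn _ hle hmem)
  apply hf (n + 1)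
  have h1 : d * (g * m) = d * f (n + 1) := by
    rw [← mul_assoc, ← hg, hb (n + 1)]
    ring
  rw [← mul_left_cancel₀ hd h1]
  exact p.mul_mem_left _ hm

theorem isDiscreteValuationRing_of_colon [IsDomain A] (h : ColonACC A) (hc : PowDvdClosed A)
    {x z : A} (hx : x ≠ 0) (hz : ¬ x ∣ z) (hu : ∀ f ∉ dvdColon x {z}, IsUnit f) :
    IsDiscreteValuationRing A := by
  -- Here `e` is a unit, so `m` is associated to `x e / z`; it is going to be the uniformizer.
  obtain ⟨m, hm, e, he, hme⟩ := hc.exists_not_mem hx hz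
  have hdvd : ∀ b, ¬ IsUnit b → m ∣ b := by
    intro b hb
    have hb' : b ∈ dvdColon x {z} := by
      by_contra h1
      exact hb (hu b h1)
    obtain ⟨b', hb'⟩ := mem_dvdColon_singleton.1 hb'
    rw [← (hu e he).dvd_mul_right]
    refine ⟨b', mul_left_cancel₀ hx ?_⟩
    calc x * (b * e) = b * (x * e) := by ring
      _ = m * (b * z) := by rw [← hme]; ring
      _ = _ := by rw [hb']; ring
  have hp : (1 : A) ∉ dvdColon x {z} := by
    rw [mem_dvdColon_singleton, one_mul]; exact hz
  have hmu : ¬ IsUnit m := fun hmu => hp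
    ((Ideal.eq_top_iff_one _).1 (Ideal.eq_top_of_isUnit_mem _ hm hmu))
  have hm0 : m ≠ 0 := by
    rintro rfl
    rw [zero_mul] at hme
    have := (mul_eq_zero.1 hme.symm).resolve_left hx
    exact he (this ▸ zero_mem _)
  refine IsDiscreteValuationRing.ofHasUnitMulPowIrreducibleFactorization ⟨m, ?_, ?_⟩
  · rw [irreducible_iff]
    refine ⟨hmu, fun a b hab => ?_⟩
    by_contra! hcon
    obtain ⟨a', rfl⟩ := hdvd a hcon.1
    apply hcon.2
    refine IsUnit.of_mul_eq_one_right a' (mul_left_cancel₀ hm0 ?_)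
    rw [← mul_assoc, ← hab, mul_one]
  · intro d hd
    obtain ⟨l, hl⟩ := h.exists_not_pow_dvd hd hmu
    have hfin : FiniteMultiplicity m d := ⟨l, fun h1 =>
      hl ((pow_dvd_pow m l.le_succ).trans h1)⟩
    obtain ⟨c, hdc, hc⟩ := hfin.exists_eq_pow_mul_and_not_dvd
    have hcu : IsUnit c := by
      by_contra h1
      exact hc (hdvd c h1)
    exact ⟨_, hdc ▸ associated_mul_unit_right _ _ hcu⟩

end Colon

/-! ### Localizing the chain condition and complete integral closedness -/

section Localization

variable {R A : Type*} [CommRing R] [CommRing A] [Algebra R A] (S : Submonoid R)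
  [IsLocalization S A]

include S in
theorem algebraMap_dvd_iff_of_isLocalization {x y : R} :
    algebraMap R A x ∣ algebraMap R A y ↔ ∃ s ∈ S, x ∣ s * y := by
  constructor
  · rintro ⟨b, hb⟩
    obtain ⟨⟨b, s⟩, rfl⟩ := IsLocalization.mk'_surjective S b
    rw [IsLocalization.mul_mk'_eq_mk'_of_mul, IsLocalization.eq_mk'_iff_mul_eq, ← map_mul,
      IsLocalization.eq_iff_exists S] at hb
    obtain ⟨c, hc⟩ := hb
    refine ⟨c * s, mul_mem c.2 s.2, ⟨c * b, ?_⟩⟩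
    linear_combination hc
  · rintro ⟨s, hs, h⟩
    have := map_dvd (algebraMap R A) h
    rwa [map_mul, (IsLocalization.map_units A ⟨s, hs⟩).dvd_mul_left] at this

/-- One multiplier `s₀` serves all `r`: take `xR : s₀ z` maximal. Hence the contraction of a colon
ideal of the localization is again a colon ideal. -/
theorem ColonACC.exists_saturated (h : ColonACC R) {x : R} (hx : x ≠ 0) (z : R) :
    ∃ s₀ ∈ S, ∀ r, (∃ s ∈ S, x ∣ s * (r * z)) → x ∣ r * (s₀ * z) := by
  obtain ⟨s₀, hs₀⟩ := h.exists_maximal hx (fun s : S => {(s : R) * z})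
  refine ⟨s₀, s₀.2, ?_⟩
  rintro r ⟨s, hs, hr⟩
  refine mem_dvdColon_singleton.1 (hs₀ (⟨s, hs⟩ * s₀) (fun q hq => ?_) ?_)
  · rw [mem_dvdColon_singleton] at hq ⊢
    exact (hq.mul_left s).trans (dvd_of_eq (by push_cast; ring))
  · rw [mem_dvdColon_singleton]
    exact (hr.mul_left s₀).trans (dvd_of_eq (by push_cast; ring))

include S in
theorem ColonACC.localization (h : ColonACC R) : ColonACC A := by
  intro x' hx'
  obtain ⟨⟨x, t⟩, rfl⟩ := IsLocalization.mk'_surjective S x'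
  have hx : x ≠ 0 := by
    rintro rfl
    exact hx' (IsLocalization.mk'_zero t)
  have hdvd : ∀ y, IsLocalization.mk' A x t ∣ y ↔ algebraMap R A x ∣ y := fun y => by
    rw [← IsLocalization.mk'_spec A x t, (IsLocalization.map_units A t).mul_right_dvd]
  choose s₀ hs₀ hsat using h.exists_saturated S hx
  have key : ∀ Z' : Set A, ∃ Z : Set R,
      (dvdColon (IsLocalization.mk' A x t) Z').comap (algebraMap R A) = dvdColon x Z := by
    intro Z'
    refine ⟨(fun z' => s₀ (IsLocalization.sec S z').1 * (IsLocalization.sec S z').1) '' Z', ?_⟩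
    ext r
    rw [Ideal.mem_comap, mem_dvdColon, mem_dvdColon, Set.forall_mem_image]
    refine forall₂_congr fun z' _ => ?_
    rw [hdvd, ← (IsLocalization.map_units A (IsLocalization.sec S z').2).dvd_mul_right, mul_assoc,
      IsLocalization.sec_spec, ← map_mul, algebraMap_dvd_iff_of_isLocalization S]
    refine ⟨fun h1 => hsat _ r h1, fun h1 => ⟨_, hs₀ (IsLocalization.sec S z').1, ?_⟩⟩
    rwa [mul_left_comm]
  have := h x hx
  let φ : Set.range (dvdColon (IsLocalization.mk' A x t)) → Set.range (dvdColon x) := fun I =>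
    ⟨I.1.comap (algebraMap R A), by
      obtain ⟨_, Z', rfl⟩ := I
      obtain ⟨Z, hZ⟩ := key Z'
      exact ⟨Z, hZ.symm⟩⟩
  have hφ : StrictMono φ := by
    refine Monotone.strictMono_of_injective (fun I J hIJ => Ideal.comap_mono hIJ) fun I J hIJ => ?_
    have h1 := congrArg (fun I => Ideal.map (algebraMap R A) I.1) hIJ
    simp only [φ, ← Ideal.under_def, IsLocalization.map_under S] at h1
    exact Subtype.ext h1
  exact hφ.wellFoundedGT

-- Complete integral closedness does not localize in general; the chain condition supplies a colon
-- prime `p` of `a` disjoint from `S`. For `m ∈ p` and `e ∉ p` with `m z = a e`, almost integrality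
-- over the localization makes `m ^ l` divide `d` times an element outside `p` for every `l`.
include S in
theorem PowDvdClosed.localization [IsDomain R] [IsDomain A] (hS : S ≤ nonZeroDivisors R)
    (h : ColonACC R) (hc : PowDvdClosed R) : PowDvdClosed A := by
  intro a' b' d' hd' hab
  obtain ⟨⟨a, s⟩, rfl⟩ := IsLocalization.mk'_surjective S a'
  obtain ⟨⟨b, t⟩, rfl⟩ := IsLocalization.mk'_surjective S b'
  obtain ⟨⟨d, u⟩, rfl⟩ := IsLocalization.mk'_surjective S d'
  have hunit : ∀ s : S, IsUnit (algebraMap R A s) := IsLocalization.map_units A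
  have hd : d ≠ 0 := by
    rintro rfl
    exact hd' (IsLocalization.mk'_zero u)
  have hpow : ∀ n, ∃ s ∈ S, a ^ n ∣ s * (d * b ^ n) := fun n => by
    rw [← algebraMap_dvd_iff_of_isLocalization S (A := A), map_mul, map_pow, map_pow,
      ← IsLocalization.mk'_spec A a s, ← IsLocalization.mk'_spec A b t,
      ← IsLocalization.mk'_spec A d u, mul_pow, mul_pow, ((hunit s).pow n).mul_right_dvd,
      ← mul_assoc, ((hunit t).pow n).dvd_mul_right, mul_right_comm, (hunit u).dvd_mul_right]
    exact hab n
  have hgoal : ∃ s ∈ S, a ∣ s * b := by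
    by_cases ha : a = 0
    · subst ha
      obtain ⟨s, hs, h1⟩ := hpow 1
      rw [pow_one, zero_dvd_iff, pow_one, mul_eq_zero, mul_eq_zero] at h1
      obtain h1 | h1 | h1 := h1
      · exact (nonZeroDivisors.ne_zero (hS hs) h1).elim
      · exact (hd h1).elim
      · exact ⟨1, one_mem _, by rw [h1]; simp⟩
    by_contra! hcon
    obtain ⟨s₀, hs₀, hsat⟩ := h.exists_saturated S ha b
    obtain ⟨z, hz, ⟨w, rfl⟩, hp⟩ := exists_prime_colon h ha (hcon s₀ hs₀)
    have hdisj : ∀ s ∈ S, s ∉ dvdColon a {s₀ * b * w} := by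
      intro s hs hmem
      rw [mem_dvdColon_singleton] at hmem
      refine hz ((hsat w ⟨s * s₀, mul_mem hs hs₀, ?_⟩).trans (dvd_of_eq (by ring)))
      exact hmem.trans (dvd_of_eq (by ring))
    obtain ⟨m, hm, e, he, hme⟩ := hc.exists_not_mem ha hz
    obtain ⟨l, hl⟩ := h.exists_forall_not_pow_dvd hm hd
    obtain ⟨s, hs, g, hg⟩ := hpow l
    refine hl (s * e ^ l) ?_ ?_
    · exact hp.mul_notMem (hdisj s hs) fun h1 => he (hp.mem_of_pow_mem _ h1)
    · refine ⟨g * (s₀ * w) ^ l, mul_left_cancel₀ (pow_ne_zero l ha) ?_⟩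
      calc a ^ l * (d * (s * e ^ l)) = d * s * (a * e) ^ l := by ring
        _ = (s * (d * b ^ l)) * (m * (s₀ * w)) ^ l := by rw [← hme]; ring
        _ = _ := by rw [hg]; ring
  rw [← algebraMap_dvd_iff_of_isLocalization S (A := A)] at hgoal
  rwa [← IsLocalization.mk'_spec A a s, ← IsLocalization.mk'_spec A b t,
    (hunit s).mul_right_dvd, (hunit t).dvd_mul_right] at hgoal

end Localization

/-! ### Finiteness of the maximal associated primes of an element -/

section AssociatedPrimes

variable {A : Type*} [CommRing A]

/-- The ideals that are maximal among the colon ideals `xA : z` with `z ∉ xA`. -/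
def maximalColons (x : A) : Set (Ideal A) :=
  {p | ∃ z, ¬ x ∣ z ∧ p = dvdColon x {z} ∧
    ∀ w, ¬ x ∣ w → p ≤ dvdColon x {w} → dvdColon x {w} ≤ p}

theorem ColonACC.exists_le_maximalColons (h : ColonACC A) {x w : A} (hx : x ≠ 0) (hw : ¬ x ∣ w) :
    ∃ p ∈ maximalColons x, dvdColon x {w} ≤ p := by
  let ι := {z : A // ¬ x ∣ z ∧ dvdColon x {w} ≤ dvdColon x {z}}
  have : Nonempty ι := ⟨⟨w, hw, le_rfl⟩⟩
  obtain ⟨⟨z, hz, hwz⟩, hmax⟩ := h.exists_maximal hx (fun i : ι => {i.1})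
  exact ⟨_, ⟨z, hz, rfl, fun v hv hle => hmax ⟨v, hv, hwz.trans hle⟩ hle⟩, hwz⟩

theorem ColonACC.isPrime_of_mem_maximalColons (h : ColonACC A) {x : A} (hx : x ≠ 0) {p : Ideal A}
    (hp : p ∈ maximalColons x) : p.IsPrime := by
  obtain ⟨z, hz, rfl, hmax⟩ := hp
  obtain ⟨v, hv, ⟨u, rfl⟩, hprime⟩ := exists_prime_colon h hx hz
  have hle : dvdColon x {z} ≤ dvdColon x {z * u} := fun r hr => by
    rw [mem_dvdColon_singleton] at hr ⊢
    rw [← mul_assoc]; exact hr.mul_right u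
  rwa [le_antisymm hle (hmax _ hv hle)]

theorem ColonACC.finite_maximalColons (h : ColonACC A) {x : A} (hx : x ≠ 0) :
    (maximalColons x).Finite := by
  by_contra hinf
  let e := Set.Infinite.natEmbedding _ hinf
  have hprime : ∀ n, (e n).1.IsPrime := fun n => h.isPrime_of_mem_maximalColons hx (e n).2
  have hmem := fun n => (e n).2
  choose z hz hez hmax using hmem
  let Z : ℕ → Set A := fun n => z '' Set.Iio n
  have hZ : Monotone Z := fun m n hmn => Set.image_mono (Set.Iio_subset_Iio hmn)
  -- Intersections of the primes descend, so the chain condition is applied to their colons, which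
  -- ascend; a further colon (`dvdColon_triple`) brings the intersections back.
  obtain ⟨n, hn⟩ := h.exists_maximal hx (fun n => (dvdColon x (Z n) : Set A))
  have h1 := hn (n + 1) (dvdColon_anti x (dvdColon_anti x (hZ n.le_succ)))
  have h2 := dvdColon_anti x (Z := (dvdColon x (dvdColon x (Z (n + 1)) : Set A) : Set A)) h1
  rw [dvdColon_triple, dvdColon_triple] at h2
  have h3 : (Finset.range n).inf (fun i => (e i).1) ≤ (e n).1 := by
    intro r hr
    rw [Submodule.mem_finsetInf] at hr
    have hrZ : r ∈ dvdColon x (Z n) := by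
      rintro _ ⟨i, hi, rfl⟩
      have := hr i (Finset.mem_range.2 hi)
      rwa [hez, mem_dvdColon_singleton] at this
    rw [hez, mem_dvdColon_singleton]
    exact h2 hrZ _ ⟨n, n.lt_succ_self, rfl⟩
  obtain ⟨i, hi, hle⟩ := (hprime n).inf_le'.1 h3
  have hge := hmax i (z n) (hz n) (by rw [← hez n]; exact hle)
  rw [← hez n] at hge
  have := e.injective (Subtype.ext (le_antisymm hle hge))
  rw [Finset.mem_range] at hi
  omega

end AssociatedPrimes

/-! ### From the hypotheses on `R` and `K` to divisibility -/

section FractionField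

variable {R K : Type*} [CommRing R] [Field K] [Algebra R K]

theorem isDivisorialIdeal_dvdColon [IsFractionRing R K] {x : R} (hx : x ≠ 0) (Z : Set R) :
    IsDivisorialIdeal K (dvdColon x Z) := by
  have hxK : algebraMap R K x ≠ 0 := by simpa using hx
  refine ⟨fun h => hx (by simpa [h] using self_mem_dvdColon x Z), le_antisymm ?_ ?_⟩
  · intro y hy
    rw [Submodule.mem_div_iff_forall_mul_mem] at hy
    have h1 : (1 : K) ∈ (1 : Submodule R K) / IsLocalization.coeSubmodule K (dvdColon x Z) := by
      rw [Submodule.mem_div_iff_forall_mul_mem]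
      intro a ha
      obtain ⟨r, -, rfl⟩ := (IsLocalization.mem_coeSubmodule _ _).1 ha
      exact Submodule.mem_one.2 ⟨r, by simp⟩
    obtain ⟨r, hr⟩ := Submodule.mem_one.1 (hy 1 h1)
    rw [mul_one] at hr
    refine (IsLocalization.mem_coeSubmodule _ _).2 ⟨r, fun z hz => ?_, hr⟩
    -- Both `1` and `z/x` multiply the colon ideal into `R`; testing `y` against them gives `y ∈ R`
    -- and `y z / x ∈ R`.
    have h2 : algebraMap R K z / algebraMap R K x ∈
        (1 : Submodule R K) / IsLocalization.coeSubmodule K (dvdColon x Z) := by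
      rw [Submodule.mem_div_iff_forall_mul_mem]
      intro a ha
      obtain ⟨s, hs, rfl⟩ := (IsLocalization.mem_coeSubmodule _ _).1 ha
      obtain ⟨q, hq⟩ := hs z hz
      refine Submodule.mem_one.2 ⟨q, ?_⟩
      rw [div_mul_eq_mul_div, eq_div_iff hxK, ← map_mul, ← map_mul, mul_comm q, ← hq, mul_comm]
    obtain ⟨q, hq⟩ := Submodule.mem_one.1 (hy _ h2)
    refine ⟨q, IsFractionRing.injective R K ?_⟩
    rw [map_mul, map_mul, hq, hr]
    field_simp
  · intro y hy
    rw [Submodule.mem_div_iff_forall_mul_mem]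
    intro a ha
    rw [Submodule.mem_div_iff_forall_mul_mem] at ha
    rw [mul_comm]
    exact ha y hy

variable (R K) in
theorem IsMoriDomain.colonACC [IsDomain R] [IsFractionRing R K] (h : IsMoriDomain R K) :
    ColonACC R := by
  intro x hx
  have : WellFoundedGT {I : Ideal R // IsDivisorialIdeal K I} := h
  let φ : Set.range (dvdColon x) → {I : Ideal R // IsDivisorialIdeal K I} := fun I =>
    ⟨I.1, by
      obtain ⟨_, Z, rfl⟩ := I
      exact isDivisorialIdeal_dvdColon hx Z⟩
  have hφ : StrictMono φ := fun _ _ hIJ => hIJ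
  exact hφ.wellFoundedGT

variable (R K) in
theorem completeIntegralClosure.hasConductor [IsFractionRing R K]
    (hcond : (1 : Submodule R K) / Subalgebra.toSubmodule (completeIntegralClosure R K) ≠ ⊥) :
    HasConductor R (completeIntegralClosure R K) := by
  have hinj : Function.Injective (algebraMap R (completeIntegralClosure R K)) := fun a b hab =>
    IsFractionRing.injective R K (congrArg Subtype.val hab)
  refine ⟨hinj, ?_⟩
  obtain ⟨y, hy, hy0⟩ := Submodule.exists_mem_ne_zero_of_ne_bot hcond
  rw [Submodule.mem_div_iff_forall_mul_mem] at hy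
  obtain ⟨c, hc⟩ := Submodule.mem_one.1 (hy 1 (one_mem (completeIntegralClosure R K)))
  rw [mul_one] at hc
  refine ⟨c, ?_, fun b => ?_⟩
  · rintro rfl
    exact hy0 (by rw [← hc, map_zero])
  · obtain ⟨a, ha⟩ := Submodule.mem_one.1 (hy b.1 b.2)
    refine ⟨a, Subtype.ext ?_⟩
    change algebraMap R K a = algebraMap R K c * b.1
    rw [ha, hc]

-- A complete integral closure need not be completely integrally closed; here a conductor element
-- turns a denominator for powers over `B` into one over `R`.
variable (R K) in
theorem completeIntegralClosure.powDvdClosed [IsDomain R]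
    (h : HasConductor R (completeIntegralClosure R K)) :
    PowDvdClosed (completeIntegralClosure R K) := by
  intro a b d hd hab
  by_cases ha : a = 0
  · have := hab 1
    rw [ha, pow_one, zero_dvd_iff, pow_one, mul_eq_zero] at this
    rw [this.resolve_left hd]
    exact dvd_zero a
  have haK : a.1 ≠ 0 := fun h0 => ha (Subtype.ext h0)
  obtain ⟨c, hc, hcB⟩ := h.exists_conductor
  obtain ⟨r, hr⟩ := hcB d
  have hr0 : r ≠ 0 := by
    rintro rfl
    rw [map_zero] at hr
    refine mul_ne_zero ?_ hd hr.symm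
    rwa [Ne, map_eq_zero_iff _ h.inj]
  have hq : b.1 / a.1 ∈ completeIntegralClosure R K := by
    refine ⟨r, mem_nonZeroDivisors_of_ne_zero hr0, fun n => ?_⟩
    obtain ⟨q, hq⟩ := hab n
    obtain ⟨s, hs⟩ := hcB q
    refine ⟨s, ?_⟩
    have hr' : algebraMap R K r = algebraMap R K c * d.1 := congrArg Subtype.val hr
    have hs' : algebraMap R K s = algebraMap R K c * q.1 := congrArg Subtype.val hs
    have hq' : d.1 * b.1 ^ n = a.1 ^ n * q.1 := by simpa using congrArg Subtype.val hq
    rw [Algebra.smul_def, hr', hs', div_pow, mul_div_assoc', eq_div_iff (pow_ne_zero n haK),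
      mul_assoc _ d.1, hq']
    ring
  refine ⟨⟨_, hq⟩, Subtype.ext ?_⟩
  change b.1 = a.1 * (b.1 / a.1)
  field_simp

end FractionField

/-! ### Extensions with nonzero conductor -/

section Conductor

variable {R B : Type*} [CommRing R] [CommRing B] [Algebra R B]

/-- The conductor of `R` in `B`, as a set of elements of `B`. -/
def conductorSet (R B : Type*) [CommRing R] [CommRing B] [Algebra R B] : Set B :=
  {e | ∀ b : B, ∃ a : R, algebraMap R B a = e * b}

theorem mul_mem_conductorSet {e : B} (he : e ∈ conductorSet R B) (b : B) :
    e * b ∈ conductorSet R B := fun b' => by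
  rw [mul_assoc]; exact he _

/-- The conductor is an ideal of `B`, so if `a/y` maps it into `R` it maps it into itself; thus
`a/y` is almost integral. -/
theorem PowDvdClosed.dvd_of_conductorSet [IsDomain B] (hB : PowDvdClosed B)
    (h : HasConductor R B) {y a : B} (hy : y ≠ 0)
    (H : ∀ e ∈ conductorSet R B, ∃ ρ : R, a * e = y * algebraMap R B ρ) : y ∣ a := by
  obtain ⟨c, hc, hcB⟩ := h.exists_conductor
  have hcB0 : algebraMap R B c ≠ 0 := by rwa [Ne, map_eq_zero_iff _ h.inj]
  refine hB y a (algebraMap R B c) hcB0 fun n => ?_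
  suffices ∃ e ∈ conductorSet R B, algebraMap R B c * a ^ n = y ^ n * e by
    obtain ⟨e, -, he⟩ := this
    exact ⟨e, he⟩
  induction n with
  | zero => exact ⟨_, hcB, by simp⟩
  | succ n ih =>
    obtain ⟨e, he, h1⟩ := ih
    obtain ⟨ρ, hρ⟩ := H e he
    refine ⟨algebraMap R B ρ, fun b => ?_, ?_⟩
    · obtain ⟨ρ', hρ'⟩ := H _ (mul_mem_conductorSet he b)
      refine ⟨ρ', mul_left_cancel₀ hy ?_⟩
      rw [← hρ', ← mul_assoc, hρ, mul_assoc]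
    · rw [pow_succ, ← mul_assoc, h1, mul_assoc, mul_comm e, hρ, pow_succ, mul_assoc]

/-- Multiplication by `c` embeds the ideals of `B` into those of `R`, and takes colons of `x` to
colons of `X = cx`. -/
theorem ColonACC.of_hasConductor [IsDomain B] (hR : ColonACC R) (h : HasConductor R B)
    (hB : PowDvdClosed B) : ColonACC B := by
  intro x hx
  obtain ⟨c, hc, hcB⟩ := h.exists_conductor
  have hcB0 : algebraMap R B c ≠ 0 := by rwa [Ne, map_eq_zero_iff _ h.inj]
  obtain ⟨X, hX⟩ := hcB x
  have hX0 : X ≠ 0 := by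
    rintro rfl
    rw [map_zero] at hX
    exact mul_ne_zero hcB0 hx hX.symm
  have hXB : algebraMap R B X ≠ 0 := by rwa [Ne, map_eq_zero_iff _ h.inj]
  have := hR X hX0
  -- Putting `x` itself among the `z` forces `r x ∈ c x B`, that is, `r ∈ cB`.
  have key : ∀ Z : Set B, (Ideal.span {algebraMap R B c} * dvdColon x Z).comap (algebraMap R B) =
      dvdColon X {q | ∃ z ∈ insert x Z, ∃ e ∈ conductorSet R B, algebraMap R B q = z * e} := by
    intro Z
    ext r
    rw [Ideal.mem_comap, Ideal.mem_span_singleton_mul]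
    constructor
    · rintro ⟨b, hb, hbr⟩ q ⟨z, hz, e, he, hq⟩
      have hxz : x ∣ b * z := by
        obtain rfl | hz := hz
        · exact dvd_mul_left _ _
        · exact hb z hz
      obtain ⟨g, hg⟩ := hxz
      obtain ⟨ρ, hρ⟩ := he g
      refine ⟨ρ, h.inj ?_⟩
      rw [map_mul, map_mul, ← hbr, hq, hρ, hX]
      linear_combination algebraMap R B c * e * hg
    · intro H
      have H' : ∀ z ∈ insert x Z, algebraMap R B X ∣ algebraMap R B r * z := by
        intro z hz
        refine hB.dvd_of_conductorSet h hXB fun e he => ?_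
        obtain ⟨q, hq⟩ := he z
        obtain ⟨ρ, hρ⟩ := H q ⟨z, hz, e, he, by rw [hq, mul_comm]⟩
        refine ⟨ρ, ?_⟩
        rw [← map_mul, ← hρ, map_mul, hq]
        ring
      obtain ⟨b, hb⟩ := H' x (Set.mem_insert _ _)
      have hb' : algebraMap R B r = algebraMap R B c * b := by
        refine mul_right_cancel₀ hx ?_
        rw [hb, hX]; ring
      refine ⟨b, fun z hz => ?_, hb'.symm⟩
      obtain ⟨g, hg⟩ := H' z (Set.mem_insert_of_mem _ hz)
      refine ⟨g, mul_left_cancel₀ hcB0 ?_⟩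
      rw [← mul_assoc, ← hb', hg, hX, mul_assoc]
  let φ : Set.range (dvdColon x) → Set.range (dvdColon X) := fun I =>
    ⟨(Ideal.span {algebraMap R B c} * I.1).comap (algebraMap R B), by
      obtain ⟨_, Z, rfl⟩ := I
      exact ⟨_, (key Z).symm⟩⟩
  have hle : ∀ I J : Ideal B, (Ideal.span {algebraMap R B c} * I).comap (algebraMap R B) ≤
      (Ideal.span {algebraMap R B c} * J).comap (algebraMap R B) → I ≤ J := by
    intro I J hIJ b hb
    obtain ⟨a, ha⟩ := hcB b
    have h1 : a ∈ (Ideal.span {algebraMap R B c} * I).comap (algebraMap R B) :=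
      Ideal.mem_span_singleton_mul.2 ⟨b, hb, ha.symm⟩
    obtain ⟨b', hb', h2⟩ := Ideal.mem_span_singleton_mul.1 (hIJ h1)
    rwa [← mul_left_cancel₀ hcB0 (h2.trans ha)]
  have hφ : StrictMono φ := by
    refine Monotone.strictMono_of_injective
      (fun I J hIJ => Ideal.comap_mono (Ideal.mul_mono_right hIJ)) fun I J hIJ => ?_
    have h1 := congrArg Subtype.val hIJ
    exact Subtype.ext (le_antisymm (hle _ _ h1.le) (hle _ _ h1.ge))
  exact hφ.wellFoundedGT

/-- If `t` is invertible in `B`, every `c / t ^ l` lies in `R`, so all powers of `t` divide `c`. -/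
theorem HasConductor.not_isUnit_algebraMap [IsDomain R] (h : HasConductor R B)
    (hACC : ColonACC R) {t : R} (ht : ¬ IsUnit t) : ¬ IsUnit (algebraMap R B t) := by
  intro hu
  obtain ⟨c, hc0, hcB⟩ := h.exists_conductor
  obtain ⟨l, hl⟩ := hACC.exists_not_pow_dvd hc0 ht
  obtain ⟨b, hb⟩ := (hu.pow l).dvd (a := 1)
  obtain ⟨a, ha⟩ := hcB b
  refine hl ⟨a, h.inj ?_⟩
  rw [map_mul, ha, map_pow]
  linear_combination algebraMap R B c * hb

end Conductor

/-! ### A measure of repetition in multisets -/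

section EqualPairs

variable {A : Type*}

/-- The number of pairs of equal members of a multiset. -/
def equalPairs [DecidableEq A] (s : Multiset A) : ℕ := ∑ w ∈ s.toFinset, s.count w ^ 2

theorem equalPairs_le [DecidableEq A] (s : Multiset A) : equalPairs s ≤ s.card * s.card := by
  calc equalPairs s ≤ ∑ w ∈ s.toFinset, s.count w * s.card :=
        Finset.sum_le_sum fun w _ => by
          rw [sq]; exact Nat.mul_le_mul_left _ (Multiset.count_le_card _ _)
    _ = _ := by rw [← Finset.sum_mul, Multiset.toFinset_sum_count_eq]

theorem equalPairs_lt [DecidableEq A] {s : Multiset A} {x y : A} (hx : x ∈ s) (hy : y ∈ s)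
    (hxy : x ≠ y) (h : s.count y ≤ s.count x) :
    equalPairs s < equalPairs (x ::ₘ s.erase y) := by
  have hsub : (x ::ₘ s.erase y).toFinset ⊆ s.toFinset := fun w hw => by
    rw [Multiset.mem_toFinset, Multiset.mem_cons] at hw
    rw [Multiset.mem_toFinset]
    obtain rfl | hw := hw
    · exact hx
    · exact Multiset.mem_of_mem_erase hw
  have heq : equalPairs (x ::ₘ s.erase y) =
      ∑ w ∈ s.toFinset, (x ::ₘ s.erase y).count w ^ 2 :=
    Finset.sum_subset hsub fun w _ hw => by
      rw [Multiset.mem_toFinset, ← Multiset.count_eq_zero] at hw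
      rw [hw]; rfl
  have hx' : x ∈ s.toFinset := Multiset.mem_toFinset.2 hx
  have hy' : y ∈ s.toFinset.erase x := Finset.mem_erase.2 ⟨hxy.symm, Multiset.mem_toFinset.2 hy⟩
  rw [heq, equalPairs, ← Finset.add_sum_erase _ _ hx', ← Finset.add_sum_erase _ _ hy',
    ← Finset.add_sum_erase _ _ hx', ← Finset.add_sum_erase _ _ hy']
  have hrest : ∑ w ∈ (s.toFinset.erase x).erase y, (x ::ₘ s.erase y).count w ^ 2 =
      ∑ w ∈ (s.toFinset.erase x).erase y, s.count w ^ 2 := by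
    refine Finset.sum_congr rfl fun w hw => ?_
    rw [Finset.mem_erase, Finset.mem_erase] at hw
    rw [Multiset.count_cons_of_ne hw.2.1, Multiset.count_erase_of_ne hw.1]
  rw [hrest, Multiset.count_cons_self, Multiset.count_erase_of_ne hxy,
    Multiset.count_cons_of_ne hxy.symm, Multiset.count_erase_self]
  have hpos : 0 < s.count y := Multiset.count_pos.2 hy
  obtain ⟨k, hk⟩ := Nat.exists_eq_add_of_lt hpos
  rw [hk] at h ⊢
  have : (0 + k + 1 - 1) = k := by omega
  rw [this]
  -- The inequality is `a² + b² < (a + 1)² + (b - 1)²` for `b ≤ a`, with `b = k + 1`.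
  nlinarith

end EqualPairs

/-! ### Absorbing ideals and powers of their radicals -/

section Absorbing

variable {A : Type*} [CommRing A] {n : ℕ} {J : Ideal A}

theorem IsNAbsorbing.exists_erase_of_card_eq [DecidableEq A] (hJ : IsNAbsorbing n J)
    {s : Multiset A} (hs : s.card = n + 1) (h : s.prod ∈ J) : ∃ z ∈ s, (s.erase z).prod ∈ J := by
  obtain ⟨l, rfl⟩ := Quot.exists_rep s
  change (l : Multiset A).card = n + 1 at hs
  rw [Multiset.coe_card] at hs
  have hl : ∃ a : Fin (n + 1) → A,
      (l : Multiset A) = (Finset.univ : Finset (Fin (n + 1))).val.map a := by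
    refine ⟨fun i => l.get (i.cast hs.symm), ?_⟩
    rw [Fin.univ_val_map]
    congr 1
    refine List.ext_getElem (by simp [hs]) fun i h1 h2 => ?_
    rw [List.getElem_ofFn]
    rfl
  obtain ⟨a, hl⟩ := hl
  change (l : Multiset A).prod ∈ J at h
  change ∃ z ∈ (l : Multiset A), ((l : Multiset A).erase z).prod ∈ J
  rw [hl] at h ⊢
  obtain ⟨i, hi⟩ := hJ a h
  refine ⟨a i, Multiset.mem_map_of_mem _ (Finset.mem_univ i), ?_⟩
  have : (Finset.univ : Finset (Fin (n + 1))).val = i ::ₘ (Finset.univ.erase i).val := by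
    rw [Finset.erase_val, Multiset.cons_erase (Finset.mem_univ i)]
  rw [this, Multiset.map_cons, Multiset.erase_cons_head]
  exact hi

theorem IsNAbsorbing.exists_erase [DecidableEq A] (hJ : IsNAbsorbing n J) {s : Multiset A}
    (hs : n + 1 ≤ s.card) (h : s.prod ∈ J) : ∃ z ∈ s, (s.erase z).prod ∈ J := by
  obtain ⟨k, hk⟩ := Nat.exists_eq_add_of_le hs
  induction k generalizing s with
  | zero => exact hJ.exists_erase_of_card_eq hk h
  | succ k ih =>
    obtain ⟨a, s, rfl, hs'⟩ := Multiset.card_eq_succ_iff.1 (hk.trans (Nat.add_succ _ _))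
    obtain ⟨b, t, rfl, ht⟩ := Multiset.card_eq_succ_iff.1 (hs'.trans (Nat.add_right_comm _ _ _))
    -- Two factors are merged into one. If the merged factor is the one to drop, dropping half of it
    -- is enough.
    obtain ⟨z, hz, hz'⟩ := ih (s := (a * b) ::ₘ t) (by rw [Multiset.card_cons]; omega)
      (by simpa [mul_assoc] using h) (by rw [Multiset.card_cons]; omega)
    by_cases hza : z = a * b
    · subst hza
      rw [Multiset.erase_cons_head] at hz'
      refine ⟨a, Multiset.mem_cons_self _ _, ?_⟩
      rw [Multiset.erase_cons_head, Multiset.prod_cons]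
      exact J.mul_mem_left _ hz'
    · have hzt : z ∈ t := (Multiset.mem_cons.1 hz).resolve_left hza
      refine ⟨z, by simp [hzt], ?_⟩
      have hs2 : (a ::ₘ b ::ₘ t).erase z = a ::ₘ b ::ₘ t.erase z := by
        obtain ⟨t, rfl⟩ := Multiset.exists_cons_of_mem hzt
        rw [Multiset.erase_cons_head, Multiset.cons_swap b, Multiset.cons_swap a,
          Multiset.erase_cons_head]
      rw [Multiset.erase_cons_tail_of_mem hzt] at hz'
      rw [hs2]
      simpa [mul_assoc] using hz'

theorem IsNAbsorbing.pow_mem (hJ : IsNAbsorbing n J) {y : A} {N : ℕ} (h : y ^ N ∈ J) :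
    y ^ n ∈ J := by
  classical
  obtain hN | hN := le_total N n
  · obtain ⟨k, rfl⟩ := Nat.exists_eq_add_of_le hN
    rw [pow_add]; exact J.mul_mem_right _ h
  · obtain ⟨k, rfl⟩ := Nat.exists_eq_add_of_le hN
    induction k with
    | zero => exact h
    | succ k ih =>
      refine ih ?_ (by omega)
      obtain ⟨z, hz, hz'⟩ := hJ.exists_erase (s := Multiset.replicate (n + (k + 1)) y)
        (by rw [Multiset.card_replicate]; omega) (by rwa [Multiset.prod_replicate])
      rw [Multiset.eq_of_mem_replicate hz, ← add_assoc, Multiset.replicate_succ,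
        Multiset.erase_cons_head, Multiset.prod_replicate] at hz'
      exact hz'

theorem IsNAbsorbing.comap {B : Type*} [CommRing B] {J : Ideal B} (hJ : IsNAbsorbing n J)
    (f : A →+* B) : IsNAbsorbing n (J.comap f) := by
  intro a ha
  obtain ⟨i, hi⟩ := hJ (fun j => f (a j)) (by rw [← map_prod]; exact ha)
  exact ⟨i, by rw [Ideal.mem_comap, map_prod]; exact hi⟩

theorem isNAbsorbing_of_pow_le [IsLocalRing A] (h : IsLocalRing.maximalIdeal A ^ n ≤ J) :
    IsNAbsorbing n J := by
  intro a ha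
  by_cases hu : ∃ i, IsUnit (a i)
  · obtain ⟨i, hi⟩ := hu
    rw [← Finset.mul_prod_erase _ _ (Finset.mem_univ i), Ideal.unit_mul_mem_iff_mem _ hi] at ha
    exact ⟨i, ha⟩
  · push Not at hu
    refine ⟨0, h ?_⟩
    have := Ideal.prod_mem_prod (s := Finset.univ.erase (0 : Fin (n + 1)))
      (I := fun _ => IsLocalRing.maximalIdeal A) (x := a) (fun i _ => hu i)
    simpa [Finset.card_erase_of_mem] using this

theorem multiset_prod_mem_pow {F : Ideal A} {s : Multiset A} (h : ∀ a ∈ s, a ∈ F) :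
    s.prod ∈ F ^ s.card := by
  induction s using Multiset.induction_on with
  | empty => simp
  | cons a s ih =>
    rw [Multiset.prod_cons, Multiset.card_cons, pow_succ']
    exact Ideal.mul_mem_mul (h a (Multiset.mem_cons_self _ _))
      (ih fun b hb => h b (Multiset.mem_cons_of_mem hb))

theorem ideal_pow_le_of_multiset_prod_mem {F : Ideal A} {d : ℕ}
    (h : ∀ s : Multiset A, s.card = d → (∀ a ∈ s, a ∈ F) → s.prod ∈ J) : F ^ d ≤ J := by
  induction d generalizing J with
  | zero =>
    have h1 := h 0 rfl (by simp)
    rw [Multiset.prod_zero] at h1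
    rw [(Ideal.eq_top_iff_one J).2 h1]
    exact le_top
  | succ d ih =>
    rw [pow_succ', Ideal.mul_le]
    intro a ha b hb
    have := ih (J := Submodule.comap (LinearMap.mulLeft A a) J) (fun s hs hsF => by
      have := h (a ::ₘ s) (by rw [Multiset.card_cons, hs]) (fun b hb => by
        obtain rfl | hb := Multiset.mem_cons.1 hb
        · exact ha
        · exact hsF b hb)
      simpa using this)
    simpa using this hb

/-- Among products of `d` elements of `F` outside `J`, choose one with most repetitions. Replacing a
factor by a different one at least as frequent then lands in `J`. This permits a sum `σ` of factors
such that replacing any factor by `σ` stays outside `J`; so no factor of `σ` times the product can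
be dropped, although that product is in `J`. -/
theorem IsNAbsorbing.pow_le_of_pow_succ_le (hJ : IsNAbsorbing n J) {F : Ideal A} {d : ℕ}
    (hd : n ≤ d) (hF : F ^ (d + 1) ≤ J) : F ^ d ≤ J := by
  classical
  by_contra hcon
  let P : Multiset A → Prop := fun s => s.card = d ∧ (∀ a ∈ s, a ∈ F) ∧ s.prod ∉ J
  have hex : ∃ k, ∃ s, P s ∧ d * d - equalPairs s = k := by
    by_contra! hno
    exact hcon (ideal_pow_le_of_multiset_prod_mem fun s h1 h2 => by
      by_contra h3
      exact hno _ s ⟨h1, h2, h3⟩ rfl)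
  obtain ⟨s, ⟨hsd, hsF, hsJ⟩, hk⟩ := Nat.find_spec hex
  have hmax : ∀ x ∈ s, ∀ y ∈ s, x ≠ y → s.count y ≤ s.count x → (x ::ₘ s.erase y).prod ∈ J := by
    intro x hx y hy hxy hle
    by_contra hnot
    have hcard : (x ::ₘ s.erase y).card = d := by
      rw [Multiset.card_cons, Multiset.card_erase_add_one hy, hsd]
    have h1 := equalPairs_lt hx hy hxy hle
    have h2 := equalPairs_le (x ::ₘ s.erase y)
    rw [hcard] at h2
    refine Nat.find_min hex (m := d * d - equalPairs (x ::ₘ s.erase y)) ?_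
      ⟨_, ⟨hcard, fun a ha => ?_, hnot⟩, rfl⟩
    · rw [← hk]; omega
    · obtain rfl | ha := Multiset.mem_cons.1 ha
      · exact hsF _ hx
      · exact hsF _ (Multiset.mem_of_mem_erase ha)
  have hform : ∀ U : Finset A, U ⊆ s.toFinset →
      ∃ T ⊆ U, ∀ y ∈ U, ∑ x ∈ T, (x ::ₘ s.erase y).prod ∉ J := by
    intro U
    induction U using Finset.induction_on_max_value (fun x => s.count x) with
    | empty => exact fun _ => ⟨∅, subset_rfl, by simp⟩
    | insert a U haU hle ih =>
      intro hsub
      have has : a ∈ s := Multiset.mem_toFinset.1 (hsub (Finset.mem_insert_self a U))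
      obtain ⟨T, hTU, hT⟩ := ih ((Finset.subset_insert a U).trans hsub)
      have haT : a ∉ T := fun h => haU (hTU h)
      by_cases hTa : ∑ x ∈ T, (x ::ₘ s.erase a).prod ∈ J
      -- `U` grows by increasing multiplicity. The new summand `a` changes nothing modulo `J` at the
      -- earlier `y`, and at `a` it adds the original product, which is not in `J`.
      · refine ⟨insert a T, Finset.insert_subset_insert a hTU, fun y hy => ?_⟩
        rw [Finset.sum_insert haT]
        obtain rfl | hy := Finset.mem_insert.1 hy
        · rw [J.add_mem_iff_left hTa, Multiset.cons_erase has]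
          exact hsJ
        · rw [J.add_mem_iff_right]
          · exact hT y hy
          · exact hmax a has y (Multiset.mem_toFinset.1 (hsub (Finset.mem_insert_of_mem hy)))
              (fun h => haU (h ▸ hy)) (hle y hy)
      · refine ⟨T, hTU.trans (Finset.subset_insert a U), fun y hy => ?_⟩
        obtain rfl | hy := Finset.mem_insert.1 hy
        · exact hTa
        · exact hT y hy
  obtain ⟨T, hTs, hT⟩ := hform s.toFinset subset_rfl
  have hTF : ∑ x ∈ T, x ∈ F :=
    sum_mem fun x hx => hsF x (Multiset.mem_toFinset.1 (hTs hx))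
  have hmem : ((∑ x ∈ T, x) ::ₘ s).prod ∈ J := by
    refine hF ?_
    rw [← hsd, ← Multiset.card_cons (∑ x ∈ T, x)]
    refine multiset_prod_mem_pow fun a ha => ?_
    obtain rfl | ha := Multiset.mem_cons.1 ha
    · exact hTF
    · exact hsF a ha
  obtain ⟨z, hz, hzJ⟩ := hJ.exists_erase (by rw [Multiset.card_cons, hsd]; omega) hmem
  by_cases hzl : z = ∑ x ∈ T, x
  · rw [hzl, Multiset.erase_cons_head] at hzJ
    exact hsJ hzJ
  · have hzs : z ∈ s := (Multiset.mem_cons.1 hz).resolve_left hzl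
    rw [Multiset.erase_cons_tail_of_mem hzs, Multiset.prod_cons, Finset.sum_mul] at hzJ
    refine hT z (Multiset.mem_toFinset.2 hzs) ?_
    simpa using hzJ

/-- The `n`-th power of the radical of an `n`-absorbing ideal is contained in the ideal. -/
theorem IsNAbsorbing.radical_pow_le (hJ : IsNAbsorbing n J) : J.radical ^ n ≤ J := by
  classical
  refine ideal_pow_le_of_multiset_prod_mem fun s hs hsr => ?_
  have hsub : Ideal.span (s.toFinset : Set A) ≤ J.radical :=
    Ideal.span_le.2 fun a ha => hsr a (Multiset.mem_toFinset.1 ha)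
  -- Only the finitely many given factors matter; the ideal they span has some power in `J`, and the
  -- exponent is lowered to `n` one step at a time.
  obtain ⟨N, hN⟩ := Ideal.exists_pow_le_of_le_radical_of_fg hsub ⟨s.toFinset, rfl⟩
  have key : ∀ k, Ideal.span (s.toFinset : Set A) ^ (n + k) ≤ J →
      Ideal.span (s.toFinset : Set A) ^ n ≤ J := by
    intro k
    induction k with
    | zero => exact id
    | succ k ih => exact fun h => ih (hJ.pow_le_of_pow_succ_le (by omega) h)
  refine key N ((Ideal.pow_le_pow_right (by omega)).trans hN) ?_
  rw [← hs]
  exact multiset_prod_mem_pow fun a ha => Ideal.subset_span (by simpa using ha)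

end Absorbing

/-! ### Absorbing factorizations under localization -/

section Localization

variable {R A : Type*} [CommRing R] [CommRing A] [Algebra R A] (S : Submonoid R)
  [IsLocalization S A] {n : ℕ}

include S in
theorem IsNAbsorbing.map_algebraMap {J : Ideal R} (hJ : IsNAbsorbing n J) :
    IsNAbsorbing n (J.map (algebraMap R A)) := by
  intro a ha
  choose r hr using fun j => IsLocalization.mk'_surjective S (a j)
  have hr' : ∀ j, ∃ u : A, IsUnit u ∧ algebraMap R A (r j).1 = u * a j := fun j =>
    ⟨_, IsLocalization.map_units A (r j).2, by rw [← hr j, IsLocalization.mk'_spec']⟩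
  choose u hu hru using hr'
  have h1 : algebraMap R A (∏ j, (r j).1) ∈ J.map (algebraMap R A) := by
    rw [map_prod, Finset.prod_congr rfl fun j _ => hru j, Finset.prod_mul_distrib]
    exact Ideal.mul_mem_left _ _ ha
  obtain ⟨t, ht, htJ⟩ := (IsLocalization.algebraMap_mem_map_algebraMap_iff S A J _).1 h1
  -- The multiplier `t` is put into one factor, so that there are still `n + 1` of them.
  let r' : Fin (n + 1) → R := Function.update (fun j => (r j).1) 0 (t * (r 0).1)
  obtain ⟨i, hi⟩ := hJ r' (by
    rw [← Finset.mul_prod_erase _ _ (Finset.mem_univ 0)] at htJ ⊢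
    rw [← mul_assoc] at htJ
    convert htJ using 2
    · simp [r']
    · exact Finset.prod_congr rfl fun j hj => by simp [r', Finset.ne_of_mem_erase hj])
  refine ⟨i, ?_⟩
  have h2 : ∀ j, ∃ v : A, IsUnit v ∧ algebraMap R A (r' j) = v * a j := fun j => by
    by_cases hj : j = 0
    · subst hj
      refine ⟨algebraMap R A t * u 0, (IsLocalization.map_units A ⟨t, ht⟩).mul (hu 0), ?_⟩
      simp [r', hru, mul_assoc]
    · exact ⟨u j, hu j, by simp [r', hj, hru]⟩
  choose v hv hrv using h2
  have h3 := Ideal.mem_map_of_mem (algebraMap R A) hi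
  rw [map_prod, Finset.prod_congr rfl fun j _ => hrv j, Finset.prod_mul_distrib] at h3
  refine (Ideal.unit_mul_mem_iff_mem _ ?_).1 h3
  exact (IsUnit.prod_iff).2 fun j _ => hv j

include S in
theorem HasAbsorbingFactorization.localization (h : HasAbsorbingFactorization R n) :
    HasAbsorbingFactorization A n := by
  intro I hI
  obtain ⟨s, hs, hsI⟩ := h (I.under R) (fun h1 => hI (by
    rw [← IsLocalization.map_under S A I, h1, Ideal.map_top]))
  refine ⟨s.map (Ideal.map (algebraMap R A)), ?_, ?_⟩
  · intro J hJ
    obtain ⟨J, hJs, rfl⟩ := Multiset.mem_map.1 hJ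
    exact (hs J hJs).map_algebraMap S
  · rw [← IsLocalization.map_under S A I, ← hsI]
    exact (map_multiset_prod (Ideal.mapHom (algebraMap R A)) s).symm

end Localization

theorem isFAFDomain_iff {A : Type*} [CommRing A] :
    IsFAFDomain A ↔ IsDomain A ∧ ∃ n, 0 < n ∧ HasAbsorbingFactorization A n := by
  refine and_congr_right fun _ => ?_
  rw [afDim, sInf_lt_iff]
  constructor
  · rintro ⟨_, ⟨n, hn, h, rfl⟩, -⟩
    exact ⟨n, hn, h⟩
  · rintro ⟨n, hn, h⟩
    exact ⟨n, ⟨n, hn, h, rfl⟩, ENat.natCast_lt_top n⟩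

/-! ### Products of proper ideals -/

section Products

variable {A : Type*} [CommRing A] {n : ℕ}

theorem mem_of_multiset_prod_eq {I : Ideal A} (hI : I ≠ ⊤)
    (hirr : ∀ J L : Ideal A, J * L = I → J = ⊤ ∨ L = ⊤) {s : Multiset (Ideal A)}
    (hs : s.prod = I) : I ∈ s := by
  induction s using Multiset.induction_on with
  | empty => exact (hI (by rw [← hs, Multiset.prod_zero, Ideal.one_eq_top])).elim
  | cons a s ih =>
    rw [Multiset.prod_cons] at hs
    obtain ha | hs' := hirr _ _ hs
    · rw [ha, Ideal.top_mul] at hs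
      exact Multiset.mem_cons_of_mem (ih hs)
    · rw [hs', Ideal.mul_top] at hs
      exact hs ▸ Multiset.mem_cons_self _ _

/-- The source of absorbing ideals: an ideal with only trivial factorizations occurs among its own
absorbing factors. -/
theorem HasAbsorbingFactorization.isNAbsorbing_of_irreducible (h : HasAbsorbingFactorization A n)
    {I : Ideal A} (hI : I ≠ ⊤) (hirr : ∀ J L : Ideal A, J * L = I → J = ⊤ ∨ L = ⊤) :
    IsNAbsorbing n I := by
  obtain ⟨s, hs, hsI⟩ := h I hI
  exact hs I (mem_of_multiset_prod_eq hI hirr hsI)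

theorem HasAbsorbingFactorization.exists_proper (h : HasAbsorbingFactorization A n)
    {I : Ideal A} (hI : I ≠ ⊤) :
    ∃ s : Multiset (Ideal A), (∀ J ∈ s, J ≠ ⊤ ∧ IsNAbsorbing n J) ∧ s.prod = I := by
  classical
  obtain ⟨s, hs, rfl⟩ := h I hI
  refine ⟨s.filter (· ≠ ⊤), fun J hJ => ?_, ?_⟩
  · rw [Multiset.mem_filter] at hJ
    exact ⟨hJ.2, hs J hJ.1⟩
  · clear hI hs
    induction s using Multiset.induction_on with
    | empty => simp
    | cons a s ih =>
      by_cases ha : a = ⊤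
      · have hfilter : (a ::ₘ s).filter (· ≠ ⊤) = s.filter (· ≠ ⊤) :=
          Multiset.filter_cons_of_neg _ (not_not.2 ha)
        rw [hfilter, ih, Multiset.prod_cons, ha, Ideal.top_mul]
      · have hfilter : (a ::ₘ s).filter (· ≠ ⊤) = a ::ₘ s.filter (· ≠ ⊤) :=
          Multiset.filter_cons_of_pos _ ha
        rw [hfilter, Multiset.prod_cons, ih, Multiset.prod_cons]

theorem multiset_prod_le_pow_card {M : Ideal A} {s : Multiset (Ideal A)} (hs : ∀ J ∈ s, J ≤ M) :
    s.prod ≤ M ^ s.card := by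
  induction s using Multiset.induction_on with
  | empty => simp
  | cons a s ih =>
    rw [Multiset.prod_cons, Multiset.card_cons, pow_succ']
    exact Ideal.mul_mono (hs a (Multiset.mem_cons_self _ _))
      (ih fun J hJ => hs J (Multiset.mem_cons_of_mem hJ))

theorem pow_card_le_multiset_prod {M : Ideal A} {s : Multiset (Ideal A)} (hs : ∀ J ∈ s, M ≤ J) :
    M ^ s.card ≤ s.prod := by
  induction s using Multiset.induction_on with
  | empty => simp
  | cons a s ih =>
    rw [Multiset.prod_cons, Multiset.card_cons, pow_succ']
    exact Ideal.mul_mono (hs a (Multiset.mem_cons_self _ _))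
      (ih fun J hJ => hs J (Multiset.mem_cons_of_mem hJ))

theorem le_of_mem_multiset_prod {s : Multiset (Ideal A)} {J : Ideal A} (hJ : J ∈ s) :
    s.prod ≤ J := by
  obtain ⟨t, rfl⟩ := Multiset.exists_cons_of_mem (a := J) hJ
  rw [Multiset.prod_cons]
  exact Ideal.mul_le_left

end Products

theorem dvd_of_dvd_pow_mul {A : Type*} [CommRing A] {x y : A} (hreg : ∀ z, x ∣ y * z → x ∣ z)
    (k : ℕ) {z : A} (h : x ∣ y ^ k * z) : x ∣ z := by
  induction k with
  | zero => simpa using h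
  | succ k ih => exact ih (hreg _ (by rwa [pow_succ', mul_assoc] at h))

open IsLocalRing in
theorem isUnit_one_sub_of_mem_maximalIdeal {A : Type*} [CommRing A] [IsLocalRing A] {s : A}
    (hs : s ∈ maximalIdeal A) : IsUnit (1 - s) := by
  by_contra h
  have h1 : (1 : A) ∈ maximalIdeal A := by
    have := add_mem ((mem_maximalIdeal _).2 h) hs
    rwa [sub_add_cancel] at this
  exact (mem_maximalIdeal _).1 h1 isUnit_one

/-! ### Local FAF-domains: the maximal ideal is an associated prime -/

section Local

open IsLocalRing

variable {A : Type*} [CommRing A] [IsLocalRing A] {n : ℕ}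

theorem dvd_of_pow_mem_span_pair {x y : A} {k N : ℕ} (hkN : k < N) (hyM : y ∈ maximalIdeal A)
    (h : y ^ k ∈ Ideal.span {x, y ^ N}) : x ∣ y ^ k := by
  obtain ⟨a, b, hab⟩ := Ideal.mem_span_pair.1 h
  have hu : IsUnit (1 - b * y ^ (N - k)) := isUnit_one_sub_of_mem_maximalIdeal
    (Ideal.mul_mem_left _ _ (Ideal.pow_mem_of_mem _ hyM _ (by omega)))
  rw [← hu.dvd_mul_right]
  refine ⟨a, ?_⟩
  have : y ^ N = y ^ k * y ^ (N - k) := by rw [← pow_add]; congr 1; omega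
  linear_combination -hab + b * this

theorem span_pair_ne_top {x y : A} (hxM : x ∈ maximalIdeal A) (hyM : y ∈ maximalIdeal A) :
    Ideal.span {x, y} ≠ ⊤ := by
  intro h
  have : Ideal.span {x, y} ≤ maximalIdeal A := Ideal.span_le.2 (by
    rintro z (rfl | rfl)
    · exact hxM
    · exact hyM)
  exact (maximalIdeal.isMaximal A).ne_top (top_le_iff.1 (h ▸ this))

variable [IsDomain A]

/-- If `JL = (x, y)` with `J`, `L` proper, some product `jl` can replace `y` modulo `x`. Then `j`
and `l` are regular modulo `x`, whence `J ⊆ (x, j)` and `L ⊆ (x, l)`. So `x` lies in `JL ⊆ 𝔪x +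
(jl)`, and cancelling `x` puts a unit into `𝔪`. -/
theorem irreducible_span_pair {x y : A} (hx : x ≠ 0) (hxM : x ∈ maximalIdeal A)
    (hreg : ∀ z, x ∣ y * z → x ∣ z) (J L : Ideal A) (hJL : J * L = Ideal.span {x, y}) :
    J = ⊤ ∨ L = ⊤ := by
  by_contra! hcon
  have hJM : J ≤ maximalIdeal A := le_maximalIdeal hcon.1
  have hLM : L ≤ maximalIdeal A := le_maximalIdeal hcon.2
  -- Otherwise `y ∈ xA + 𝔪y`, so `x ∣ y` by Nakayama, against regularity.
  obtain ⟨j, hj, l, hl, r, s, hs, hjl⟩ :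
      ∃ j ∈ J, ∃ l ∈ L, ∃ r s, IsUnit s ∧ r * x + s * y = j * l := by
    by_contra! hno
    have hle : J * L ≤ Ideal.span {x} ⊔ maximalIdeal A * Ideal.span {y} := by
      rw [Ideal.mul_le]
      intro j hj l hl
      obtain ⟨r, s, hrs⟩ := Ideal.mem_span_pair.1 (hJL ▸ Ideal.mul_mem_mul hj hl)
      have hs : s ∈ maximalIdeal A := fun hs => hno j hj l hl r s hs hrs
      rw [← hrs]
      exact add_mem (Ideal.mem_sup_left (Ideal.mem_span_singleton'.2 ⟨r, rfl⟩))
        (Ideal.mem_sup_right (Ideal.mul_mem_mul hs (Ideal.mem_span_singleton_self y)))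
    have hy : y ∈ Ideal.span {x} ⊔ maximalIdeal A * Ideal.span {y} :=
      hle (hJL ▸ Ideal.subset_span (by simp))
    obtain ⟨a, ha, b, hb, hab⟩ := Submodule.mem_sup.1 hy
    rw [mul_comm, Ideal.mem_span_singleton_mul] at hb
    obtain ⟨m, hm, rfl⟩ := hb
    have hu := isUnit_one_sub_of_mem_maximalIdeal hm
    have h1 : x ∣ y := by
      rw [← hu.dvd_mul_right]
      have : y * (1 - m) = a := by linear_combination -hab
      rw [this]
      exact Ideal.mem_span_singleton.1 ha
    have h2 := hreg 1 (h1.mul_right 1)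
    exact (mem_maximalIdeal _).1 hxM (isUnit_of_dvd_one h2)
  obtain ⟨u, rfl⟩ := hs
  have hregJL : ∀ w, x ∣ j * l * w → x ∣ w := by
    intro w hw
    rw [← hjl, add_mul, mul_assoc r, mul_left_comm, dvd_add_right (dvd_mul_right _ _), mul_assoc,
      u.isUnit.dvd_mul_left] at hw
    exact hreg w hw
  have hy : ∀ β : A, β * y = β * ↑u⁻¹ * (j * l) - β * ↑u⁻¹ * r * x := fun β => by
    rw [← hjl]
    linear_combination (-β * y) * u.inv_mul
  have hJform : ∀ a ∈ J, ∃ p q, a = p * x + q * j := by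
    intro a ha
    obtain ⟨α, β, hαβ⟩ := Ideal.mem_span_pair.1 (hJL ▸ Ideal.mul_mem_mul ha hl)
    rw [hy] at hαβ
    obtain ⟨w, hw⟩ := hregJL (a - β * ↑u⁻¹ * j)
      ⟨j * (α - β * ↑u⁻¹ * r), by linear_combination -j * hαβ⟩
    exact ⟨w, β * ↑u⁻¹, by linear_combination hw⟩
  have hLform : ∀ b ∈ L, ∃ p q, b = p * x + q * l := by
    intro b hb
    obtain ⟨α, β, hαβ⟩ := Ideal.mem_span_pair.1 (hJL ▸ Ideal.mul_mem_mul hj hb)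
    rw [hy] at hαβ
    obtain ⟨w, hw⟩ := hregJL (b - β * ↑u⁻¹ * l)
      ⟨l * (α - β * ↑u⁻¹ * r), by linear_combination -l * hαβ⟩
    exact ⟨w, β * ↑u⁻¹, by linear_combination hw⟩
  have hle : J * L ≤ maximalIdeal A * Ideal.span {x} ⊔ Ideal.span {j * l} := by
    rw [Ideal.mul_le]
    intro a ha b hb
    obtain ⟨p, q, rfl⟩ := hJform a ha
    obtain ⟨p', q', rfl⟩ := hLform b hb
    have hsplit : (p * x + q * j) * (p' * x + q' * l) =
        (p * p' * x + p * q' * l + q * p' * j) * x + q * q' * (j * l) := by ring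
    rw [hsplit]
    refine add_mem (Ideal.mem_sup_left (Ideal.mul_mem_mul ?_ (Ideal.mem_span_singleton_self x)))
      (Ideal.mem_sup_right (Ideal.mem_span_singleton'.2 ⟨_, rfl⟩))
    exact add_mem (add_mem (Ideal.mul_mem_left _ _ hxM) (Ideal.mul_mem_left _ _ (hLM hl)))
      (Ideal.mul_mem_left _ _ (hJM hj))
  have hxmem : x ∈ maximalIdeal A * Ideal.span {x} ⊔ Ideal.span {j * l} :=
    hle (hJL ▸ Ideal.subset_span (by simp))
  obtain ⟨a, ha, b, hb, hab⟩ := Submodule.mem_sup.1 hxmem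
  rw [mul_comm, Ideal.mem_span_singleton_mul] at ha
  obtain ⟨m, hm, rfl⟩ := ha
  obtain ⟨ρ, rfl⟩ := Ideal.mem_span_singleton'.1 hb
  obtain ⟨ρ', rfl⟩ := hregJL ρ ⟨1 - m, by linear_combination hab⟩
  have h1 : 1 - m = ρ' * (j * l) := mul_left_cancel₀ hx (by linear_combination -hab)
  have h2 := isUnit_one_sub_of_mem_maximalIdeal hm
  rw [h1] at h2
  exact (mem_maximalIdeal _).1 (Ideal.mul_mem_left _ _ (Ideal.mul_mem_left _ _ (hLM hl))) h2

theorem HasAbsorbingFactorization.exists_not_regular (h : HasAbsorbingFactorization A n) {x y : A}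
    (hx : x ≠ 0) (hxM : x ∈ maximalIdeal A) (hyM : y ∈ maximalIdeal A) :
    ∃ z, ¬ x ∣ z ∧ x ∣ y * z := by
  by_contra! hcon
  have hreg : ∀ z, x ∣ y * z → x ∣ z := fun z hz => by
    by_contra h1
    exact hcon z h1 hz
  have hyN : y ^ (n + 1) ∈ maximalIdeal A := Ideal.pow_mem_of_mem _ hyM _ n.succ_pos
  have habs := h.isNAbsorbing_of_irreducible (span_pair_ne_top hxM hyN)
    (irreducible_span_pair hx hxM fun z => dvd_of_dvd_pow_mul hreg (n + 1))
  have hyn : y ^ n ∈ Ideal.span {x, y ^ (n + 1)} :=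
    habs.pow_mem (N := n + 1) (Ideal.subset_span (by simp))
  have h1 := dvd_of_pow_mem_span_pair n.lt_succ_self hyM hyn
  have h2 := dvd_of_dvd_pow_mul hreg n (z := 1) (by rwa [mul_one])
  exact (mem_maximalIdeal _).1 hxM (isUnit_of_dvd_one h2)

/-- All nonunits are zero divisors modulo `x`, hence covered by finitely many associated primes;
prime avoidance applies. -/
theorem HasAbsorbingFactorization.exists_maximalIdeal_eq_dvdColon
    (h : HasAbsorbingFactorization A n) (hACC : ColonACC A) {x : A} (hx : x ≠ 0)
    (hxM : x ∈ maximalIdeal A) : ∃ z, maximalIdeal A = dvdColon x {z} := by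
  have hfin := hACC.finite_maximalColons hx
  have hcover : ((maximalIdeal A : Ideal A) : Set A) ⊆
      ⋃ p ∈ (↑hfin.toFinset : Set (Ideal A)), ((id p : Ideal A) : Set A) := by
    intro y hy
    obtain ⟨z, hz, hyz⟩ := h.exists_not_regular hx hxM hy
    obtain ⟨p, hp, hle⟩ := hACC.exists_le_maximalColons hx hz
    exact Set.mem_biUnion (by simpa using hp) (hle (mem_dvdColon_singleton.2 hyz))
  obtain ⟨p, hp, hle⟩ := (Ideal.subset_union_prime ⊥ ⊥ fun p hp _ _ =>
    hACC.isPrime_of_mem_maximalColons hx (by simpa using hp)).1 hcover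
  have hp' : p ∈ maximalColons x := by simpa using hp
  have hprime := hACC.isPrime_of_mem_maximalColons hx hp'
  obtain ⟨z, -, rfl, -⟩ := hp'
  exact ⟨z, (maximalIdeal.isMaximal A).eq_of_le hprime.ne_top hle⟩

end Local

theorem ColonACC.exists_eq_dvdColon {A : Type*} [CommRing A] (hACC : ColonACC A) {P : Ideal A}
    [P.IsPrime] {x : A} (hx : x ≠ 0)
    (h : ∃ z, IsLocalRing.maximalIdeal (Localization.AtPrime P) =
      dvdColon (algebraMap A (Localization.AtPrime P) x) {z}) :
    ∃ z, P = dvdColon x {z} := by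
  obtain ⟨z', hz'⟩ := h
  obtain ⟨⟨z, s⟩, rfl⟩ := IsLocalization.mk'_surjective P.primeCompl z'
  obtain ⟨s₀, hs₀, hsat⟩ := hACC.exists_saturated P.primeCompl hx z
  refine ⟨s₀ * z, ?_⟩
  ext r
  rw [← IsLocalization.AtPrime.to_map_mem_maximal_iff (Localization.AtPrime P) P r, hz',
    mem_dvdColon_singleton, mem_dvdColon_singleton,
    ← (IsLocalization.map_units (Localization.AtPrime P) s).dvd_mul_right, mul_assoc,
    IsLocalization.mk'_spec, ← map_mul, algebraMap_dvd_iff_of_isLocalization P.primeCompl]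
  exact ⟨fun h1 => hsat r h1, fun h1 => ⟨s₀, hs₀, by rwa [mul_left_comm]⟩⟩

/-- Since FAF localizes, the local statement at `P` makes every nonzero prime a colon ideal, hence
divisorial. -/
theorem HasAbsorbingFactorization.exists_eq_dvdColon {A : Type*} [CommRing A] [IsDomain A] {n : ℕ}
    (h : HasAbsorbingFactorization A n) (hACC : ColonACC A) {P : Ideal A} [P.IsPrime] {x : A}
    (hx : x ≠ 0) (hxP : x ∈ P) : ∃ z, P = dvdColon x {z} := by
  have hinj := IsLocalization.injective (Localization.AtPrime P) P.primeCompl_le_nonZeroDivisors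
  exact hACC.exists_eq_dvdColon hx ((h.localization P.primeCompl).exists_maximalIdeal_eq_dvdColon
    (hACC.localization P.primeCompl) (by rwa [Ne, map_eq_zero_iff _ hinj])
    ((IsLocalization.AtPrime.to_map_mem_maximal_iff _ P x).2 hxP))

/-! ### Local FAF-domains: dimension one and the valuation ring -/

section Local

open IsLocalRing

variable {A : Type*} [CommRing A] [IsDomain A] [IsLocalRing A] {n : ℕ}

/-- By the chain condition a finite `F ⊆ 𝔪` has a double colon containing `𝔪`. If `𝔪` is idempotent,
absorbing factors of `(F)` with radical `𝔪` contain `𝔪`; as `𝔪` is not finitely generated, some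
factor lies in a smaller prime. That prime is divisorial, so with `F` it contains `𝔪`. -/
theorem HasAbsorbingFactorization.maximalIdeal_sq_ne (h : HasAbsorbingFactorization A n)
    (hACC : ColonACC A) (hM : maximalIdeal A ≠ ⊥) : maximalIdeal A ^ 2 ≠ maximalIdeal A := by
  classical
  intro hsq
  have hid : IsIdempotentElem (maximalIdeal A) := by rw [IsIdempotentElem, ← sq, hsq]
  have hMfg : ¬ (maximalIdeal A).FG := fun hfg => by
    obtain h1 | h1 := (Ideal.isIdempotentElem_iff_eq_bot_or_top _ hfg).1 hid
    · exact hM h1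
    · exact (maximalIdeal.isMaximal A).ne_top h1
  have hpow : ∀ k, maximalIdeal A ≤ maximalIdeal A ^ k := fun k => by
    obtain rfl | hk := Nat.eq_zero_or_pos k
    · simp
    · rw [hid.pow_eq hk.ne']
  obtain ⟨x, hxM, hx⟩ := Submodule.exists_mem_ne_zero_of_ne_bot hM
  let ι := {F : Finset A // x ∈ F ∧ (F : Set A) ⊆ maximalIdeal A}
  have : Nonempty ι := ⟨⟨{x}, by simp, by simpa using hxM⟩⟩
  obtain ⟨⟨F, hxF, hFM⟩, hmax⟩ := hACC.exists_maximal hx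
    (fun F : ι => (dvdColon x (F.1 : Set A) : Set A))
  have hMF : ∀ a ∈ maximalIdeal A, a ∈ dvdColon x (dvdColon x (F : Set A) : Set A) := by
    intro a ha
    refine hmax ⟨insert a F, Finset.mem_insert_of_mem hxF, ?_⟩ ?_ ?_
    · rw [Finset.coe_insert]
      exact Set.insert_subset ha hFM
    · exact dvdColon_anti x (dvdColon_anti x (by simp))
    · intro w hw
      rw [mul_comm]
      exact hw a (by simp)
  have hspan : Ideal.span (F : Set A) ≤ maximalIdeal A := Ideal.span_le.2 hFM
  obtain ⟨s, hs, hsF⟩ := h.exists_proper (I := Ideal.span (F : Set A)) (fun h1 =>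
    (maximalIdeal.isMaximal A).ne_top (top_le_iff.1 (h1 ▸ hspan)))
  obtain ⟨J, hJs, hJ⟩ : ∃ J ∈ s, J.radical ≠ maximalIdeal A := by
    by_contra! hall
    have hle : maximalIdeal A ≤ s.prod := by
      refine (hpow _).trans (pow_card_le_multiset_prod fun J hJ => ?_)
      refine (hpow n).trans ?_
      rw [← hall J hJ]
      exact (hs J hJ).2.radical_pow_le
    exact hMfg ⟨F, le_antisymm hspan (hle.trans hsF.le)⟩
  obtain ⟨P, hP, hJP, hPM⟩ : ∃ P : Ideal A, P.IsPrime ∧ J ≤ P ∧ P ≠ maximalIdeal A := by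
    by_contra! hall
    apply hJ
    rw [Ideal.radical_eq_sInf]
    refine le_antisymm (sInf_le ⟨le_maximalIdeal (hs J hJs).1, inferInstance⟩)
      (le_sInf fun P hP => (hall P hP.2 hP.1).ge)
  have hFP : (F : Set A) ⊆ P := fun a ha =>
    hJP (le_of_mem_multiset_prod hJs (hsF ▸ Ideal.subset_span ha))
  obtain ⟨w, hw⟩ := h.exists_eq_dvdColon hACC hx (hFP hxF)
  refine hPM (le_antisymm (le_maximalIdeal hP.ne_top) fun a ha => ?_)
  rw [hw, mem_dvdColon_singleton]
  refine hMF a ha w fun b hb => ?_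
  rw [mul_comm]
  have := hFP hb
  rw [hw] at this
  exact mem_dvdColon_singleton.1 this

/-- Some power of the maximal ideal is contained in a principal ideal `tA` with `t` a nonzero
nonunit. -/
theorem HasAbsorbingFactorization.exists_maximalIdeal_pow_le (h : HasAbsorbingFactorization A n)
    (hACC : ColonACC A) (hM : maximalIdeal A ≠ ⊥) :
    ∃ t ∈ maximalIdeal A, t ≠ 0 ∧ maximalIdeal A ^ n ≤ Ideal.span {t} := by
  obtain ⟨t, htM, ht⟩ : ∃ t ∈ maximalIdeal A, t ∉ maximalIdeal A ^ 2 := by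
    by_contra! hall
    exact h.maximalIdeal_sq_ne hACC hM (le_antisymm (Ideal.pow_le_self two_ne_zero) hall)
  -- A product of two proper ideals lies in `𝔪²`, which misses `t`.
  have hirr : ∀ I : Ideal A, t ∈ I → ∀ J L : Ideal A, J * L = I → J = ⊤ ∨ L = ⊤ := by
    intro I htI J L hJL
    by_contra! hcon
    apply ht
    rw [sq]
    exact Ideal.mul_mono (le_maximalIdeal hcon.1) (le_maximalIdeal hcon.2) (hJL ▸ htI)
  refine ⟨t, htM, fun h0 => ht (h0 ▸ zero_mem _), ?_⟩
  have htop : Ideal.span {t} ≠ ⊤ := fun h1 => (mem_maximalIdeal _).1 htM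
    (Ideal.span_singleton_eq_top.1 h1)
  have habs := h.isNAbsorbing_of_irreducible htop (hirr _ (Ideal.mem_span_singleton_self t))
  suffices (Ideal.span {t}).radical = maximalIdeal A from this ▸ habs.radical_pow_le
  rw [Ideal.radical_eq_sInf]
  refine le_antisymm (sInf_le ⟨le_maximalIdeal htop, inferInstance⟩) (le_sInf fun P hP y hy => ?_)
  by_contra hyP
  have hPprime : P.IsPrime := hP.2
  have htP : t ∈ P := hP.1 (Ideal.mem_span_singleton_self t)
  have hyN : y ^ (n + 1) ∈ maximalIdeal A := Ideal.pow_mem_of_mem _ hy _ n.succ_pos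
  have habs' := h.isNAbsorbing_of_irreducible (span_pair_ne_top htM hyN)
    (hirr _ (Ideal.subset_span (by simp)))
  have hyn : y ^ n ∈ Ideal.span {t, y ^ (n + 1)} :=
    habs'.pow_mem (N := n + 1) (Ideal.subset_span (by simp))
  have h1 := dvd_of_pow_mem_span_pair n.lt_succ_self hy hyn
  exact hyP (hPprime.mem_of_pow_mem n (P.mem_of_dvd h1 htP))

/-- For `x` in a smaller prime `P`, factor `(x, t ^ N)` with `N` large. Each factor contains `t ^
n`, so few factors would give `x ∣ t ^ k` and `t ∈ P`; many factors put `x` into a high power of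
`𝔪`, hence into `t ^ l A`. -/
theorem HasAbsorbingFactorization.eq_maximalIdeal (h : HasAbsorbingFactorization A n)
    (hn : 0 < n) (hACC : ColonACC A) {P : Ideal A} (hP : P.IsPrime) (hP0 : P ≠ ⊥) :
    P = maximalIdeal A := by
  by_contra hPM
  have hPle := le_maximalIdeal hP.ne_top
  obtain ⟨t, htM, ht0, htn⟩ := h.exists_maximalIdeal_pow_le hACC
    (fun h0 => hP0 (le_bot_iff.1 (h0 ▸ hPle)))
  have htP : t ∉ P := fun h1 => hPM (le_antisymm hPle
    (hP.le_of_pow_le (htn.trans ((Ideal.span_singleton_le_iff_mem _).2 h1))))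
  obtain ⟨x, hxP, hx⟩ := Submodule.exists_mem_ne_zero_of_ne_bot hP0
  obtain ⟨l, hl⟩ := hACC.exists_not_pow_dvd hx ((mem_maximalIdeal t).1 htM)
  apply hl
  obtain rfl | hl0 := Nat.eq_zero_or_pos l
  · simp
  -- The exponent is chosen so that fewer than `n * l` factors leave `t ^ (n * s.card)` a strictly
  -- lower power.
  have hNpos : 0 < n * (n * l) := by positivity
  obtain ⟨s, hs, hsI⟩ := h.exists_proper (span_pair_ne_top (hPle hxP)
    (Ideal.pow_mem_of_mem _ htM _ hNpos))
  have hxs : x ∈ s.prod := hsI ▸ Ideal.subset_span (by simp)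
  have hts : t ^ (n * s.card) ∈ s.prod := by
    rw [pow_mul, ← Ideal.span_singleton_le_iff_mem, ← Ideal.span_singleton_pow]
    refine pow_card_le_multiset_prod fun J hJ => (Ideal.span_singleton_le_iff_mem _).2 ?_
    refine (hs J hJ).2.pow_mem (N := n * (n * l)) (le_of_mem_multiset_prod hJ ?_)
    exact hsI ▸ Ideal.subset_span (by simp)
  have hcard : n * l ≤ s.card := by
    by_contra! hlt
    rw [hsI] at hts
    have := dvd_of_pow_mem_span_pair (Nat.mul_lt_mul_of_pos_left hlt hn) htM hts
    exact htP (hP.mem_of_pow_mem _ (P.mem_of_dvd this hxP))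
  have h1 : x ∈ maximalIdeal A ^ (n * l) := Ideal.pow_le_pow_right hcard
    (multiset_prod_le_pow_card (fun J hJ => le_maximalIdeal (hs J hJ).1) hxs)
  rw [pow_mul] at h1
  have h2 := Ideal.pow_right_mono htn l h1
  rwa [Ideal.span_singleton_pow, Ideal.mem_span_singleton] at h2

theorem HasAbsorbingFactorization.isDiscreteValuationRing (h : HasAbsorbingFactorization A n)
    (hn : 0 < n) (hACC : ColonACC A) (hM : maximalIdeal A ≠ ⊥) {B : Type*} [CommRing B]
    [IsDomain B] [Algebra A B] (hAB : HasConductor A B) (hB : PowDvdClosed B) :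
    IsDiscreteValuationRing B := by
  have hBACC := hACC.of_hasConductor hAB hB
  obtain ⟨t, htM, ht0, htn⟩ := h.exists_maximalIdeal_pow_le hACC hM
  obtain ⟨c, hc0, hcB⟩ := hAB.exists_conductor
  have hinj0 : ∀ a : A, a ≠ 0 → algebraMap A B a ≠ 0 := fun a ha => by
    rwa [Ne, map_eq_zero_iff _ hAB.inj]
  have htB : ¬ algebraMap A B t ∣ 1 := fun hdvd =>
    hAB.not_isUnit_algebraMap hACC ((mem_maximalIdeal t).1 htM) (isUnit_of_dvd_one hdvd)
  obtain ⟨z, hz, -, hp⟩ := exists_prime_colon hBACC (hinj0 t ht0) htB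
  refine isDiscreteValuationRing_of_colon hBACC hB (hinj0 t ht0) hz fun a hap => ?_
  obtain ⟨l, hl⟩ := hBACC.exists_forall_not_pow_dvd
    (self_mem_dvdColon (algebraMap A B t) {z}) (d := algebraMap A B (c * t))
    (hinj0 _ (mul_ne_zero hc0 ht0))
  -- A fixed power of `t` is divisible by every `a ^ N`, so `1/a` is almost integral. With `q = c a
  -- ^ N`, the ideal `(qt)` has fewer than `n * l` factors, since otherwise `t ^ l` divides `c t a ^
  -- N` against the choice of `l`; each factor contains `𝔪 ^ n`.
  have hpow : ∀ N : ℕ, a ^ N ∣ algebraMap A B (t ^ (n * (n * l))) * 1 ^ N := by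
    intro N
    rw [one_pow, mul_one]
    obtain ⟨q, hq⟩ := hcB (a ^ N)
    have ha0 : a ≠ 0 := fun h0 => hap (h0 ▸ zero_mem _)
    have hq0 : q ≠ 0 := by
      rintro rfl
      rw [map_zero] at hq
      exact mul_ne_zero (hinj0 c hc0) (pow_ne_zero N ha0) hq.symm
    have hqtM : q * t ∈ maximalIdeal A := Ideal.mul_mem_left _ _ htM
    obtain ⟨s, hs, hsI⟩ := h.exists_proper (I := Ideal.span {q * t}) (fun h1 =>
      (mem_maximalIdeal _).1 hqtM (Ideal.span_singleton_eq_top.1 h1))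
    have hle : ∀ J ∈ s, maximalIdeal A ^ n ≤ J := by
      intro J hJ
      have hJ0 : J ≠ ⊥ := by
        rintro rfl
        have h0 := le_of_mem_multiset_prod hJ (hsI ▸ Ideal.mem_span_singleton_self (q * t))
        exact mul_ne_zero hq0 ht0 (by simpa using h0)
      suffices J.radical = maximalIdeal A from this ▸ (hs J hJ).2.radical_pow_le
      rw [Ideal.radical_eq_sInf]
      refine le_antisymm (sInf_le ⟨le_maximalIdeal (hs J hJ).1, inferInstance⟩)
        (le_sInf fun P hP => ?_)
      rw [h.eq_maximalIdeal hn hACC hP.2 (fun h0 => hJ0 (le_bot_iff.1 (h0 ▸ hP.1)))]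
    have hcard : s.card < n * l := by
      by_contra! hlt
      have h1 : q * t ∈ maximalIdeal A ^ (n * l) := Ideal.pow_le_pow_right hlt
        (multiset_prod_le_pow_card (fun J hJ => le_maximalIdeal (hs J hJ).1)
          (hsI ▸ Ideal.mem_span_singleton_self (q * t)))
      rw [pow_mul] at h1
      have h2 := Ideal.pow_right_mono htn l h1
      rw [Ideal.span_singleton_pow, Ideal.mem_span_singleton] at h2
      have h3 := map_dvd (algebraMap A B) h2
      rw [map_pow] at h3
      refine hl (a ^ N) (fun h4 => hap (hp.mem_of_pow_mem N h4)) (h3.trans (dvd_of_eq ?_))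
      rw [map_mul, map_mul, hq]
      ring
    have h1 : t ^ (n * (n * l)) ∈ Ideal.span {q * t} := by
      rw [← hsI]
      refine (pow_card_le_multiset_prod hle) ?_
      rw [← pow_mul]
      exact Ideal.pow_le_pow_right (Nat.mul_le_mul_left n hcard.le)
        (Ideal.pow_mem_pow htM _)
    have h2 := map_dvd (algebraMap A B) (Ideal.mem_span_singleton.1 h1)
    refine Dvd.dvd.trans ⟨algebraMap A B c * algebraMap A B t, ?_⟩ h2
    rw [map_mul, hq]
    ring
  exact isUnit_of_dvd_one (hB a 1 _ (hinj0 _ (pow_ne_zero _ ht0)) hpow)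

end Local

/-! ### Domains dominated by a discrete valuation ring -/

section ConductorExtension

variable {A B : Type*} [CommRing A] [CommRing B] [Algebra A B]

theorem HasConductor.isFractionRing [IsDomain B] (h : HasConductor A B) (L : Type*) [Field L]
    [Algebra A L] [Algebra B L] [IsScalarTower A B L] [IsFractionRing B L] :
    IsFractionRing A L := by
  obtain ⟨c, hc0, hcB⟩ := h.exists_conductor
  have hinj : Function.Injective (algebraMap A L) := by
    rw [IsScalarTower.algebraMap_eq A B L]
    exact (IsFractionRing.injective B L).comp h.inj
  have : FaithfulSMul A L := (faithfulSMul_iff_algebraMap_injective A L).2 hinj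
  refine IsFractionRing.of_field A L fun z => ?_
  obtain ⟨b, d, hd, rfl⟩ := IsFractionRing.div_surjective (A := B) z
  obtain ⟨x, hx⟩ := hcB b
  obtain ⟨y, hy⟩ := hcB d
  refine ⟨x, y, ?_⟩
  rw [IsScalarTower.algebraMap_apply A B L, IsScalarTower.algebraMap_apply A B L, hx, hy, map_mul,
    map_mul, mul_div_mul_left]
  rw [← IsScalarTower.algebraMap_apply A B L]
  exact fun h0 => hc0 (hinj (h0.trans (map_zero _).symm))

end ConductorExtension

theorem IsDiscreteValuationRing.exists_dvd_pow {B : Type*} [CommRing B] [IsDomain B]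
    [IsDiscreteValuationRing B] {y a : B} (hy : y ≠ 0) (ha : ¬ IsUnit a) : ∃ k : ℕ, y ∣ a ^ k := by
  obtain ⟨π, hπ⟩ := IsDiscreteValuationRing.exists_irreducible B
  obtain ⟨k, hk⟩ := IsDiscreteValuationRing.associated_pow_irreducible hy hπ
  refine ⟨k, hk.dvd.trans (pow_dvd_pow_of_dvd ?_ k)⟩
  rw [← Ideal.mem_span_singleton, ← hπ.maximalIdeal_eq]
  exact (IsLocalRing.mem_maximalIdeal a).2 ha

section Local

open IsLocalRing

variable {A B : Type*} [CommRing A] [IsDomain A] [CommRing B] [IsDomain B] [Algebra A B]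

/-- For `0 ≠ x ∈ P`, some power of a nonunit `a` is a multiple of `xc` in `B`, hence a multiple of
`x` in `A`. -/
theorem HasConductor.eq_maximalIdeal [IsLocalRing A] [IsDiscreteValuationRing B]
    (h : HasConductor A B) (hACC : ColonACC A) {P : Ideal A} (hP : P.IsPrime) (hP0 : P ≠ ⊥) :
    P = maximalIdeal A := by
  refine le_antisymm (le_maximalIdeal hP.ne_top) fun a ha => ?_
  obtain ⟨x, hxP, hx⟩ := Submodule.exists_mem_ne_zero_of_ne_bot hP0
  obtain ⟨c, hc0, hcB⟩ := h.exists_conductor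
  obtain ⟨k, b, hb⟩ := IsDiscreteValuationRing.exists_dvd_pow (y := algebraMap A B (x * c))
    (by rw [Ne, map_eq_zero_iff _ h.inj]; exact mul_ne_zero hx hc0)
    (h.not_isUnit_algebraMap hACC ((mem_maximalIdeal a).1 ha))
  obtain ⟨r, hr⟩ := hcB b
  refine hP.mem_of_pow_mem k (P.mem_of_dvd ⟨r, h.inj ?_⟩ hxP)
  rw [map_pow, hb, map_mul, map_mul, hr]
  ring

theorem HasConductor.isFractional_of_isDiscreteValuationRing [IsDiscreteValuationRing B]
    (h : HasConductor A B) {L : Type*} [Field L] [Algebra A L] [Algebra B L] [IsScalarTower A B L]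
    [IsFractionRing B L] (T : Subalgebra A L) (hT : T ≠ ⊤) :
    IsFractional (nonZeroDivisors A) (Subalgebra.toSubmodule T) := by
  obtain ⟨c, hc0, hcB⟩ := h.exists_conductor
  have hcB0 : algebraMap A B c ≠ 0 := by rwa [Ne, map_eq_zero_iff _ h.inj]
  have hBL : ∀ {b : B}, b ≠ 0 → algebraMap B L b ≠ 0 := fun hb => by
    rwa [Ne, map_eq_zero_iff _ (IsFractionRing.injective B L)]
  refine ⟨c, mem_nonZeroDivisors_of_ne_zero hc0, fun y hy => ?_⟩
  change y ∈ T at hy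
  -- A proper overring lies in `B`: an element `y ∉ B` has a nonunit inverse `b'`, and high powers
  -- of `b'` absorb `c` and any denominator, so `A[y]` is the whole field.
  obtain ⟨b, hb⟩ : ∃ b, algebraMap B L b = y := by
    by_contra hyB
    obtain ⟨b', hb'⟩ := (ValuationRing.isInteger_or_isInteger B y).resolve_left hyB
    have hy0 : y ≠ 0 := by
      rintro rfl
      exact hyB ⟨0, map_zero _⟩
    have hyb : algebraMap B L b' * y = 1 := by rw [hb', inv_mul_cancel₀ hy0]
    have hnu : ¬ IsUnit b' := by
      rintro ⟨u, rfl⟩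
      refine hyB ⟨↑u⁻¹, ?_⟩
      have h1 : algebraMap B L ↑u⁻¹ * algebraMap B L ↑u = 1 := by
        rw [← map_mul, u.inv_mul, map_one]
      linear_combination y * h1 - algebraMap B L ↑u⁻¹ * hyb
    refine hT (eq_top_iff.2 fun w _ => ?_)
    obtain ⟨b₁, b₂, hb₂, rfl⟩ := IsFractionRing.div_surjective (A := B) w
    have hb₂0 := nonZeroDivisors.ne_zero hb₂
    obtain ⟨k, d, hd⟩ := IsDiscreteValuationRing.exists_dvd_pow (mul_ne_zero hcB0 hb₂0) hnu
    obtain ⟨a, ha⟩ := hcB (b₁ * d)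
    have hw : algebraMap B L b₁ / algebraMap B L b₂ = algebraMap A L a * y ^ k := by
      rw [div_eq_iff (hBL hb₂0), IsScalarTower.algebraMap_apply A B L, ha, map_mul, map_mul]
      have h1 : algebraMap B L b' ^ k * y ^ k = 1 := by rw [← mul_pow, hyb, one_pow]
      rw [← map_pow, hd, map_mul, map_mul] at h1
      linear_combination -algebraMap B L b₁ * h1
    rw [hw]
    exact T.mul_mem (T.algebraMap_mem a) (T.pow_mem hy k)
  obtain ⟨a, ha⟩ := hcB b
  refine ⟨a, ?_⟩
  rw [Algebra.smul_def, ← hb, IsScalarTower.algebraMap_apply A B L,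
    IsScalarTower.algebraMap_apply A B L, ha, map_mul]

theorem HasConductor.isDiscreteValuationRing_of_isFractional (h : HasConductor A B)
    (hACC : ColonACC A) (hB : PowDvdClosed B) (hA : ¬ IsField A) {L : Type*} [Field L]
    [Algebra A L] [Algebra B L] [IsScalarTower A B L] [IsFractionRing B L]
    (hfrac : ∀ T : Subalgebra A L, T ≠ ⊤ →
      IsFractional (nonZeroDivisors A) (Subalgebra.toSubmodule T)) :
    IsDiscreteValuationRing B := by
  have hBACC := hACC.of_hasConductor h hB
  have hBinj := IsFractionRing.injective B L
  obtain ⟨x, hx0, hx⟩ : ∃ x : A, x ≠ 0 ∧ ¬ IsUnit x := by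
    by_contra! hall
    exact hA ⟨⟨0, 1, zero_ne_one⟩, mul_comm, fun ha => (hall _ ha).exists_right_inv⟩
  have hxB0 : algebraMap A B x ≠ 0 := by rwa [Ne, map_eq_zero_iff _ h.inj]
  have hxu : ¬ algebraMap A B x ∣ 1 := fun h1 =>
    h.not_isUnit_algebraMap hACC hx (isUnit_of_dvd_one h1)
  obtain ⟨z, hz, -, hp⟩ := exists_prime_colon hBACC hxB0 hxu
  refine isDiscreteValuationRing_of_colon hBACC hB hxB0 hz fun f hf => ?_
  -- The localization of `B` at the colon prime; it is proper since it misses `1/x`.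
  let T : Subalgebra A L :=
    { carrier := {y | ∃ f ∉ dvdColon (algebraMap A B x) {z}, ∃ b, algebraMap B L f * y =
        algebraMap B L b}
      mul_mem' := by
        rintro y y' ⟨f, hf, b, hb⟩ ⟨f', hf', b', hb'⟩
        refine ⟨f * f', hp.mul_notMem hf hf', b * b', ?_⟩
        rw [map_mul, map_mul, ← hb, ← hb']; ring
      add_mem' := by
        rintro y y' ⟨f, hf, b, hb⟩ ⟨f', hf', b', hb'⟩
        refine ⟨f * f', hp.mul_notMem hf hf', b * f' + b' * f, ?_⟩
        rw [map_mul, map_add, map_mul, map_mul, ← hb, ← hb']; ring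
      algebraMap_mem' := fun a => ⟨1, fun h1 => hp.ne_top ((Ideal.eq_top_iff_one _).2 h1),
        algebraMap A B a, by rw [map_one, one_mul, ← IsScalarTower.algebraMap_apply]⟩ }
  have hT : T ≠ ⊤ := by
    intro htop
    obtain ⟨f, hf, b, hb⟩ : (algebraMap B L (algebraMap A B x))⁻¹ ∈ T := by
      rw [htop]; exact Algebra.mem_top
    rw [mul_inv_eq_iff_eq_mul₀ (by rwa [Ne, map_eq_zero_iff _ hBinj]), ← map_mul] at hb
    apply hf
    rw [hBinj hb]
    exact Ideal.mul_mem_left _ _ (self_mem_dvdColon _ _)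
  obtain ⟨s, hs, hsT⟩ := hfrac T hT
  have hf0 : f ≠ 0 := fun h0 => hf (h0 ▸ zero_mem _)
  have hfL : algebraMap B L f ≠ 0 := by rwa [Ne, map_eq_zero_iff _ hBinj]
  refine isUnit_of_dvd_one (hB f 1 (algebraMap A B s) ?_ fun n => ?_)
  · rw [Ne, map_eq_zero_iff _ h.inj]
    exact nonZeroDivisors.ne_zero hs
  · have hmem : (algebraMap B L f ^ n)⁻¹ ∈ T :=
      ⟨f ^ n, fun h1 => hf (hp.mem_of_pow_mem n h1), 1, by
        rw [map_pow, map_one, mul_inv_cancel₀ (pow_ne_zero n hfL)]⟩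
    obtain ⟨a, ha⟩ := hsT _ hmem
    refine ⟨algebraMap A B a, hBinj ?_⟩
    rw [one_pow, mul_one, map_mul, ← IsScalarTower.algebraMap_apply A B L,
      ← IsScalarTower.algebraMap_apply A B L, ha, Algebra.smul_def, map_pow]
    field_simp

/-- If the conductor element `c` has value `e` and `t` is a nonunit of value `f`, then each nonzero
ideal of `A` is a product of ideals containing the `(f + 2e)`-th power of the maximal ideal. -/
theorem HasConductor.exists_factorization [IsLocalRing A] [IsDiscreteValuationRing B]
    (h : HasConductor A B) (hACC : ColonACC A) {π : B} (hπ : Irreducible π) {c t : A} {e f : ℕ}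
    (hcB : ∀ b : B, ∃ a : A, algebraMap A B a = algebraMap A B c * b)
    (hce : Associated (algebraMap A B c) (π ^ e)) (htM : t ∈ maximalIdeal A)
    (htf : Associated (algebraMap A B t) (π ^ f)) {I : Ideal A} (hI : I ≠ ⊥) :
    ∃ s : Multiset (Ideal A), (∀ J ∈ s, maximalIdeal A ^ (f + 2 * e) ≤ J) ∧ s.prod = I := by
  have hπ0 := hπ.ne_zero
  have hlift : ∀ b : B, π ^ e ∣ b → ∃ a : A, algebraMap A B a = b := by
    rintro b hb
    obtain ⟨b, rfl⟩ := hce.dvd.trans hb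
    exact hcB b
  have hMpow : ∀ k, ∀ a ∈ maximalIdeal A ^ k, π ^ k ∣ algebraMap A B a := by
    intro k a ha
    have hle : (maximalIdeal A).map (algebraMap A B) ≤ Ideal.span {π} := by
      rw [← hπ.maximalIdeal_eq, Ideal.map_le_iff_le_comap]
      exact fun a ha => (mem_maximalIdeal _).2
        (h.not_isUnit_algebraMap hACC ((mem_maximalIdeal a).1 ha))
    have h1 := Ideal.pow_right_mono hle k (by
      rw [← Ideal.map_pow]; exact Ideal.mem_map_of_mem _ ha)
    rwa [Ideal.span_singleton_pow, Ideal.mem_span_singleton] at h1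
  have hf : 0 < f := by
    refine Nat.pos_of_ne_zero fun hf => ?_
    rw [hf, pow_zero, associated_one_iff_isUnit] at htf
    exact h.not_isUnit_algebraMap hACC ((mem_maximalIdeal t).1 htM) htf
  have ht0 : t ≠ 0 := by
    rintro rfl
    rw [map_zero] at htf
    exact pow_ne_zero f hπ0 (htf.symm.eq_zero_iff.2 rfl)
  have key : ∀ m : ℕ, ∀ I : Ideal A, (∀ y ∈ I, π ^ m ∣ algebraMap A B y) →
      (∃ y ∈ I, Associated (algebraMap A B y) (π ^ m)) →
      ∃ s : Multiset (Ideal A), (∀ J ∈ s, maximalIdeal A ^ (f + 2 * e) ≤ J) ∧ s.prod = I := by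
    intro m
    induction m using Nat.strong_induction_on with
    | _ m ih =>
    intro I hIm hex
    obtain ⟨y, hyI, hy⟩ := hex
    -- Here `m` is the least value in `I`. Elements of value at least `m + e` are multiples of `y`
    -- in `A`, so for small `m` the ideal contains the required power; otherwise `t` divides all of
    -- `I` and `m` drops by `f`.
    by_cases hm : m < f + e
    · refine ⟨{I}, fun J hJ a ha => ?_, Multiset.prod_singleton I⟩
      rw [Multiset.mem_singleton.1 hJ]
      have h1 : π ^ m * π ^ e ∣ algebraMap A B a := by
        rw [← pow_add]
        exact (pow_dvd_pow π (by omega)).trans (hMpow _ a ha)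
      obtain ⟨b, hb⟩ := ((hy.mul_right _).dvd_iff_dvd_left).2 h1
      obtain ⟨r, hr⟩ := hlift (π ^ e * b) (dvd_mul_right _ _)
      refine I.mem_of_dvd ⟨r, h.inj ?_⟩ hyI
      rw [hb, map_mul, hr, mul_assoc]
    · push Not at hm
      have hIt : ∀ y ∈ I, t ∣ y := by
        intro y hy
        have h1 : π ^ f * π ^ e ∣ algebraMap A B y := by
          rw [← pow_add]
          exact (pow_dvd_pow π hm).trans (hIm y hy)
        obtain ⟨b, hb⟩ := ((htf.mul_right _).dvd_iff_dvd_left).2 h1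
        obtain ⟨r, hr⟩ := hlift (π ^ e * b) (dvd_mul_right _ _)
        refine ⟨r, h.inj ?_⟩
        rw [hb, map_mul, hr, mul_assoc]
      let J : Ideal A := Submodule.comap (LinearMap.mulLeft A t) I
      have hJ : Ideal.span {t} * J = I := by
        ext y
        rw [Ideal.mem_span_singleton_mul]
        constructor
        · rintro ⟨z, hz, rfl⟩
          exact hz
        · intro hy
          obtain ⟨z, rfl⟩ := hIt y hy
          exact ⟨z, hy, rfl⟩
      have hpow : (π ^ m : B) = π ^ f * π ^ (m - f) := by
        rw [← pow_add]; congr 1; omega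
      obtain ⟨s, hs, hsJ⟩ := ih (m - f) (by omega) J
        (by
          intro z hz
          have h1 := hIm _ (show t * z ∈ I from hz)
          rw [map_mul, hpow, ← (htf.mul_right _).dvd_iff_dvd_left] at h1
          refine (mul_dvd_mul_iff_left ?_).1 h1
          rwa [Ne, map_eq_zero_iff _ h.inj])
        (by
          obtain ⟨z, rfl⟩ := hIt y hyI
          refine ⟨z, hyI, ?_⟩
          rw [map_mul, hpow] at hy
          exact hy.of_mul_left htf (by rwa [Ne, map_eq_zero_iff _ h.inj]))
      refine ⟨Ideal.span {t} ::ₘ s, fun L hL => ?_, by rw [Multiset.prod_cons, hsJ, hJ]⟩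
      obtain rfl | hL := Multiset.mem_cons.1 hL
      · intro a ha
        have h1 : π ^ f * π ^ e ∣ algebraMap A B a := by
          rw [← pow_add]
          exact (pow_dvd_pow π (by omega)).trans (hMpow _ a ha)
        obtain ⟨b, hb⟩ := ((htf.mul_right _).dvd_iff_dvd_left).2 h1
        obtain ⟨r, hr⟩ := hlift (π ^ e * b) (dvd_mul_right _ _)
        refine Ideal.mem_span_singleton.2 ⟨r, h.inj ?_⟩
        rw [hb, map_mul, hr, mul_assoc]
      · exact hs L hL
  classical
  have hex : ∃ m, ∃ y ∈ I, Associated (algebraMap A B y) (π ^ m) := by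
    obtain ⟨y, hyI, hy⟩ := Submodule.exists_mem_ne_zero_of_ne_bot hI
    obtain ⟨m, hm⟩ := IsDiscreteValuationRing.associated_pow_irreducible
      (x := algebraMap A B y) (by rwa [Ne, map_eq_zero_iff _ h.inj]) hπ
    exact ⟨m, y, hyI, hm⟩
  refine key (Nat.find hex) I (fun y hy => ?_) (Nat.find_spec hex)
  by_cases hy0 : algebraMap A B y = 0
  · rw [hy0]; exact dvd_zero _
  obtain ⟨m, hm⟩ := IsDiscreteValuationRing.associated_pow_irreducible hy0 hπ
  exact (pow_dvd_pow π (Nat.find_min' hex ⟨y, hy, hm⟩)).trans hm.symm.dvd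

/-- There is `n` such that each nonzero ideal of `A` is a product of ideals containing the `n`-th
power of the maximal ideal, and `n = 1` works if the conductor is trivial. -/
theorem HasConductor.exists_uniform_factorization [IsLocalRing A] [IsDiscreteValuationRing B]
    (h : HasConductor A B) (hACC : ColonACC A) (hA : ¬ IsField A) {c : A} (hc0 : c ≠ 0)
    (hcB : ∀ b : B, ∃ a : A, algebraMap A B a = algebraMap A B c * b) :
    ∃ n, (IsUnit c → n = 1) ∧ ∀ I : Ideal A, I ≠ ⊥ →
      ∃ s : Multiset (Ideal A), (∀ J ∈ s, maximalIdeal A ^ n ≤ J) ∧ s.prod = I := by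
  obtain ⟨π, hπ⟩ := IsDiscreteValuationRing.exists_irreducible B
  by_cases hc : IsUnit c
  -- For a unit `c`, `A` maps onto `B`, so a uniformizer lifts and the constants are `e = 0`, `f =
  -- 1`.
  · obtain ⟨t', ht'⟩ := hcB π
    have hassoc : Associated (algebraMap A B t') π := by
      rw [ht']
      exact associated_unit_mul_left _ _ (hc.map _)
    refine ⟨1, fun _ => rfl, fun I hI => ?_⟩
    refine h.exists_factorization hACC hπ (e := 0) (f := 1) (t := t') hcB ?_ ?_
      (by rwa [pow_one]) hI
    · rw [pow_zero, associated_one_iff_isUnit]; exact hc.map _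
    · refine (mem_maximalIdeal _).2 fun hu => hπ.not_isUnit ?_
      exact hassoc.isUnit (hu.map _)
  · obtain ⟨t, htM, ht0⟩ := Submodule.exists_mem_ne_zero_of_ne_bot
      (p := maximalIdeal A) (fun h0 => hA (isField_iff_maximalIdeal_eq.2 h0))
    obtain ⟨e, he⟩ := IsDiscreteValuationRing.associated_pow_irreducible
      (x := algebraMap A B c) (by rwa [Ne, map_eq_zero_iff _ h.inj]) hπ
    obtain ⟨f, hf⟩ := IsDiscreteValuationRing.associated_pow_irreducible
      (x := algebraMap A B t) (by rwa [Ne, map_eq_zero_iff _ h.inj]) hπ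
    exact ⟨f + 2 * e, fun h1 => (hc h1).elim, fun I hI =>
      h.exists_factorization hACC hπ hcB he htM hf hI⟩

end Local

theorem forall_isFractional_of_algEquiv {A L L' : Type*} [CommRing A] [Field L] [Field L']
    [Algebra A L] [Algebra A L'] (e : L ≃ₐ[A] L')
    (H : ∀ T : Subalgebra A L, T ≠ ⊤ →
      IsFractional (nonZeroDivisors A) (Subalgebra.toSubmodule T))
    (T : Subalgebra A L') (hT : T ≠ ⊤) :
    IsFractional (nonZeroDivisors A) (Subalgebra.toSubmodule T) := by
  obtain ⟨a, ha, haT⟩ := H (T.comap e.toAlgHom) (fun h => hT (eq_top_iff.2 fun y _ => by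
    have : e.symm y ∈ T.comap e.toAlgHom := by rw [h]; exact Algebra.mem_top
    simpa using this))
  refine ⟨a, ha, fun y hy => ?_⟩
  obtain ⟨r, hr⟩ := haT (e.symm y) (show e (e.symm y) ∈ T by simpa using hy)
  refine ⟨r, ?_⟩
  have := congrArg e hr
  simpa using this

theorem isConducive_iff {A : Type*} [CommRing A] [IsDomain A] (L : Type*) [Field L] [Algebra A L]
    [IsFractionRing A L] :
    IsConducive A ↔ ∀ T : Subalgebra A L, T ≠ ⊤ →
      IsFractional (nonZeroDivisors A) (Subalgebra.toSubmodule T) :=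
  ⟨forall_isFractional_of_algEquiv (FractionRing.algEquiv A L),
    forall_isFractional_of_algEquiv (FractionRing.algEquiv A L).symm⟩

theorem HasConductor.isConducive_iff {A B : Type*} [CommRing A] [IsDomain A] [CommRing B]
    [IsDomain B] [Algebra A B] (h : HasConductor A B) (hACC : ColonACC A) (hB : PowDvdClosed B)
    (hA : ¬ IsField A) : IsConducive A ↔ IsDiscreteValuationRing B := by
  have : IsFractionRing A (FractionRing B) := h.isFractionRing _
  rw [_root_.isConducive_iff (FractionRing B)]
  exact ⟨h.isDiscreteValuationRing_of_isFractional hACC hB hA,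
    fun _ T hT => h.isFractional_of_isDiscreteValuationRing T hT⟩

open IsLocalRing

/-! ### Localizing the extension at a prime of `R` -/

section Localize

variable {R B : Type*} [CommRing R] [CommRing B] [Algebra R B]

/-- The localization of an `R`-algebra `B` at the complement of a prime ideal of `R`. -/
abbrev LocalizedAlgebra (B : Type*) [CommRing B] [Algebra R B] (M : Ideal R) [M.IsPrime] : Type _ :=
  Localization (Algebra.algebraMapSubmonoid B M.primeCompl)

variable (M : Ideal R) [M.IsPrime]

theorem algebraMap_localizedAlgebra (r : R) :
    algebraMap (Localization.AtPrime M) (LocalizedAlgebra B M) (algebraMap R _ r) =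
      algebraMap B (LocalizedAlgebra B M) (algebraMap R B r) := by
  rw [← IsScalarTower.algebraMap_apply R (Localization.AtPrime M) (LocalizedAlgebra B M),
    ← IsScalarTower.algebraMap_apply R B (LocalizedAlgebra B M)]

variable [IsDomain B]

theorem HasConductor.algebraMapSubmonoid_le (h : HasConductor R B) :
    Algebra.algebraMapSubmonoid B M.primeCompl ≤ nonZeroDivisors B := by
  rintro _ ⟨s, hs, rfl⟩
  refine mem_nonZeroDivisors_of_ne_zero ?_
  rw [Ne, map_eq_zero_iff _ h.inj]
  rintro rfl
  exact hs (zero_mem M)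

theorem HasConductor.isDomain_localizedAlgebra (h : HasConductor R B) :
    IsDomain (LocalizedAlgebra B M) :=
  IsLocalization.isDomain_localization (h.algebraMapSubmonoid_le M)

theorem HasConductor.injective_localizedAlgebra (h : HasConductor R B) :
    Function.Injective (algebraMap B (LocalizedAlgebra B M)) :=
  IsLocalization.injective _ (h.algebraMapSubmonoid_le M)

/-- The same `c` works at every prime; uniform bounds later depend on its being a unit at almost all
of them. -/
theorem HasConductor.localization_of_mem (h : HasConductor R B) {c : R}
    (hcB : ∀ b : B, ∃ a : R, algebraMap R B a = algebraMap R B c * b) (b : LocalizedAlgebra B M) :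
    ∃ a : Localization.AtPrime M, algebraMap _ (LocalizedAlgebra B M) a =
      algebraMap _ (LocalizedAlgebra B M) (algebraMap R (Localization.AtPrime M) c) * b := by
  have := h.isDomain_localizedAlgebra M
  obtain ⟨⟨b, s⟩, rfl⟩ :=
    IsLocalization.mk'_surjective (Algebra.algebraMapSubmonoid B M.primeCompl) b
  obtain ⟨_, s, hs, rfl⟩ := s
  obtain ⟨r, hr⟩ := hcB b
  refine ⟨IsLocalization.mk' _ r (⟨s, hs⟩ : M.primeCompl), ?_⟩
  have hu := IsLocalization.map_units (LocalizedAlgebra B M)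
    (⟨algebraMap R B s, s, hs, rfl⟩ : Algebra.algebraMapSubmonoid B M.primeCompl)
  refine hu.mul_right_cancel ?_
  rw [mul_assoc, IsLocalization.mk'_spec, ← algebraMap_localizedAlgebra, ← map_mul,
    algebraMap_localizedAlgebra, ← map_mul, ← hr, ← algebraMap_localizedAlgebra]
  congr 1
  exact IsLocalization.mk'_spec (Localization.AtPrime M) r (⟨s, hs⟩ : M.primeCompl)

theorem HasConductor.powDvdClosed_localizedAlgebra (h : HasConductor R B) (hACC : ColonACC R)
    (hB : PowDvdClosed B) : PowDvdClosed (LocalizedAlgebra B M) := by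
  have := h.isDomain_localizedAlgebra M
  exact hB.localization _ (h.algebraMapSubmonoid_le M) (hACC.of_hasConductor h hB)

variable [IsDomain R]

theorem HasConductor.localization (h : HasConductor R B) :
    HasConductor (Localization.AtPrime M) (LocalizedAlgebra B M) := by
  have := h.isDomain_localizedAlgebra M
  constructor
  · rw [injective_iff_map_eq_zero]
    intro a ha
    obtain ⟨⟨r, s⟩, rfl⟩ := IsLocalization.mk'_surjective M.primeCompl a
    have h1 := congrArg (algebraMap (Localization.AtPrime M) (LocalizedAlgebra B M))
      (IsLocalization.mk'_spec (Localization.AtPrime M) r s)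
    rw [map_mul, ha, zero_mul, algebraMap_localizedAlgebra, eq_comm,
      map_eq_zero_iff _ (h.injective_localizedAlgebra M), map_eq_zero_iff _ h.inj] at h1
    rw [h1]
    exact IsLocalization.mk'_zero s
  · obtain ⟨c, hc0, hcB⟩ := h.exists_conductor
    refine ⟨algebraMap R _ c, ?_, h.localization_of_mem M hcB⟩
    rwa [Ne, map_eq_zero_iff _
      (IsLocalization.injective (Localization.AtPrime M) M.primeCompl_le_nonZeroDivisors)]

theorem maximalIdeal_localization_ne_bot (hM : M ≠ ⊥) :
    maximalIdeal (Localization.AtPrime M) ≠ ⊥ := by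
  obtain ⟨x, hxM, hx⟩ := Submodule.exists_mem_ne_zero_of_ne_bot hM
  intro h0
  have h1 := (IsLocalization.AtPrime.to_map_mem_maximal_iff (Localization.AtPrime M) M x).2 hxM
  rw [h0, Ideal.mem_bot, map_eq_zero_iff _
      (IsLocalization.injective (Localization.AtPrime M) M.primeCompl_le_nonZeroDivisors)] at h1
  exact hx h1

theorem not_isField_localization (hM : M ≠ ⊥) : ¬ IsField (Localization.AtPrime M) := fun hf =>
  maximalIdeal_localization_ne_bot M hM (isField_iff_maximalIdeal_eq.1 hf)

end Localize

/-! ### Conducive, unibranched and the discrete valuation rings `B_M` -/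

section Global

variable {R B : Type*} [CommRing R] [IsDomain R] [CommRing B] [IsDomain B] [Algebra R B]

theorem HasConductor.localized_isDiscreteValuationRing_of_isFAFDomain (h : HasConductor R B)
    (hACC : ColonACC R) (hB : PowDvdClosed B) {M : Ideal R} [M.IsPrime] (hM : M ≠ ⊥)
    (hFAF : IsFAFDomain (Localization.AtPrime M)) [IsDomain (LocalizedAlgebra B M)] :
    IsDiscreteValuationRing (LocalizedAlgebra B M) := by
  obtain ⟨-, n, hn, hfac⟩ := isFAFDomain_iff.1 hFAF
  exact hfac.isDiscreteValuationRing hn (hACC.localization M.primeCompl)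
    (maximalIdeal_localization_ne_bot M hM) (h.localization M)
    (h.powDvdClosed_localizedAlgebra M hACC hB)

theorem HasConductor.isConducive_localization_iff (h : HasConductor R B)
    (hACC : ColonACC R) (hB : PowDvdClosed B) {M : Ideal R} [M.IsPrime] (hM : M ≠ ⊥)
    [IsDomain (LocalizedAlgebra B M)] :
    IsConducive (Localization.AtPrime M) ↔ IsDiscreteValuationRing (LocalizedAlgebra B M) :=
  (h.localization M).isConducive_iff (hACC.localization M.primeCompl)
    (h.powDvdClosed_localizedAlgebra M hACC hB) (not_isField_localization M hM)

theorem HasConductor.existsUnique_prime_over (h : HasConductor R B) (hACC : ColonACC R)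
    {M : Ideal R} [hM : M.IsMaximal] (hM0 : M ≠ ⊥) [IsDomain (LocalizedAlgebra B M)]
    [IsDiscreteValuationRing (LocalizedAlgebra B M)] :
    ∃! Q : Ideal B, Q.IsPrime ∧ Q.comap (algebraMap R B) = M := by
  have hloc := h.localization M
  refine ⟨(maximalIdeal (LocalizedAlgebra B M)).under B, ⟨Ideal.IsPrime.under _ _, ?_⟩, ?_⟩
  · have hprime : ((maximalIdeal (LocalizedAlgebra B M)).under B).IsPrime :=
      Ideal.IsPrime.under _ _
    refine (hM.eq_of_le (hprime.comap (algebraMap R B)).ne_top fun r hr => ?_).symm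
    rw [Ideal.mem_comap, Ideal.under_def, Ideal.mem_comap, ← algebraMap_localizedAlgebra,
      mem_maximalIdeal]
    refine hloc.not_isUnit_algebraMap (hACC.localization M.primeCompl) ?_
    exact (mem_maximalIdeal _).1
      ((IsLocalization.AtPrime.to_map_mem_maximal_iff (Localization.AtPrime M) M r).2 hr)
  · rintro Q ⟨hQ, hQM⟩
    have hdisj : Disjoint (Algebra.algebraMapSubmonoid B M.primeCompl : Set B) (Q : Set B) := by
      rw [Set.disjoint_left]
      rintro _ ⟨s, hs, rfl⟩ hsQ
      exact hs (hQM ▸ hsQ : s ∈ M)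
    have hQ' := IsLocalization.isPrime_of_isPrime_disjoint
      (Algebra.algebraMapSubmonoid B M.primeCompl) (LocalizedAlgebra B M) Q hQ hdisj
    have hQ0 : Q.map (algebraMap B (LocalizedAlgebra B M)) ≠ ⊥ := by
      obtain ⟨x, hxM, hx⟩ := Submodule.exists_mem_ne_zero_of_ne_bot hM0
      intro h0
      have h1 := Ideal.mem_map_of_mem (algebraMap B (LocalizedAlgebra B M))
        (hQM ▸ hxM : x ∈ Q.comap (algebraMap R B))
      rw [h0, Ideal.mem_bot, map_eq_zero_iff _ (h.injective_localizedAlgebra M),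
        map_eq_zero_iff _ h.inj] at h1
      exact hx h1
    rw [← IsLocalization.under_map_of_isPrime_disjoint
      (Algebra.algebraMapSubmonoid B M.primeCompl) (LocalizedAlgebra B M) hQ hdisj]
    congr 1
    exact IsLocalRing.eq_maximalIdeal (hQ'.isMaximal hQ0)

theorem HasConductor.localized_isDiscreteValuationRing_of_isUnibranched (h : HasConductor R B)
    (hACC : ColonACC R) (hB : PowDvdClosed B) (hdim : Ring.KrullDimLE 1 R)
    (huni : IsUnibranched R B) {M : Ideal R} [hM : M.IsMaximal] (hM0 : M ≠ ⊥)
    [IsDomain (LocalizedAlgebra B M)] : IsDiscreteValuationRing (LocalizedAlgebra B M) := by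
  have hloc := h.localization M
  have hBloc := h.powDvdClosed_localizedAlgebra M hACC hB
  have hACCloc := (hACC.localization (A := Localization.AtPrime M) M.primeCompl).of_hasConductor
    hloc hBloc
  have hinj : Function.Injective (algebraMap R (Localization.AtPrime M)) :=
    IsLocalization.injective _ M.primeCompl_le_nonZeroDivisors
  -- A nonzero prime of `B_M` meets `R` in a nonzero prime, by the conductor, which lies in `M` and
  -- so equals it in dimension one.
  have hover : ∀ q : Ideal (LocalizedAlgebra B M), q.IsPrime → q ≠ ⊥ →
      (q.under B).comap (algebraMap R B) = M := by
    intro q hq hq0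
    have hprime : ((q.under B).comap (algebraMap R B)).IsPrime :=
      (Ideal.IsPrime.under B q).comap _
    have hne : (q.under B).comap (algebraMap R B) ≠ ⊥ := by
      obtain ⟨f, hf, hf0⟩ := Submodule.exists_mem_ne_zero_of_ne_bot hq0
      obtain ⟨⟨b, s⟩, rfl⟩ :=
        IsLocalization.mk'_surjective (Algebra.algebraMapSubmonoid B M.primeCompl) f
      obtain ⟨c, hc0, hcB⟩ := h.exists_conductor
      obtain ⟨r, hr⟩ := hcB b
      have hb0 : b ≠ 0 := by
        rintro rfl
        exact hf0 (IsLocalization.mk'_zero s)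
      have hrq : r ∈ (q.under B).comap (algebraMap R B) := by
        rw [Ideal.mem_comap, hr, Ideal.under_def]
        refine Ideal.mul_mem_left _ _ ?_
        rw [Ideal.mem_comap, ← IsLocalization.mk'_spec (LocalizedAlgebra B M) b s]
        exact Ideal.mul_mem_right _ _ hf
      intro h0
      rw [h0, Ideal.mem_bot] at hrq
      rw [hrq, map_zero] at hr
      refine mul_ne_zero ?_ hb0 hr.symm
      rwa [Ne, map_eq_zero_iff _ h.inj]
    refine (Ring.krullDimLE_one_iff_of_noZeroDivisors.1 hdim _ hne hprime).eq_of_le hM.ne_top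
      fun r hr => ?_
    by_contra hrM
    refine hq.ne_top (Ideal.eq_top_of_isUnit_mem _ hr ?_)
    exact IsLocalization.map_units (LocalizedAlgebra B M)
      (⟨_, r, hrM, rfl⟩ : Algebra.algebraMapSubmonoid B M.primeCompl)
  obtain ⟨x, hxM, hx⟩ := Submodule.exists_mem_ne_zero_of_ne_bot hM0
  have hx0 : algebraMap (Localization.AtPrime M) (LocalizedAlgebra B M) (algebraMap R _ x) ≠ 0 := by
    rwa [Ne, map_eq_zero_iff _ hloc.inj, map_eq_zero_iff _ hinj]
  have hxu : ¬ algebraMap (Localization.AtPrime M) (LocalizedAlgebra B M) (algebraMap R _ x) ∣ 1 :=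
    fun h1 => hloc.not_isUnit_algebraMap (hACC.localization M.primeCompl) ((mem_maximalIdeal _).1
      ((IsLocalization.AtPrime.to_map_mem_maximal_iff (Localization.AtPrime M) M x).2 hxM))
      (isUnit_of_dvd_one h1)
  obtain ⟨z, hz, -, hp⟩ := exists_prime_colon hACCloc hx0 hxu
  refine isDiscreteValuationRing_of_colon hACCloc hBloc hx0 hz fun f hf => ?_
  by_contra hfu
  obtain ⟨m, hm, hfm⟩ := exists_max_ideal_of_mem_nonunits hfu
  have hp0 : dvdColon (algebraMap (Localization.AtPrime M) (LocalizedAlgebra B M)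
      (algebraMap R _ x)) {z} ≠ ⊥ := fun h0 =>
    hx0 ((Submodule.eq_bot_iff _).1 h0 _ (self_mem_dvdColon _ _))
  have hm0 : m ≠ ⊥ := fun h0 => hf (by
    rw [(Submodule.eq_bot_iff _).1 h0 f hfm]
    exact zero_mem _)
  -- Both the colon prime and a maximal ideal containing `f` lie over `M`, so they agree, although
  -- `f` is outside the first.
  have huniq := (huni M hM.isPrime).unique ⟨Ideal.IsPrime.under B _, hover _ hp hp0⟩
    ⟨Ideal.IsPrime.under B _, hover _ hm.isPrime hm0⟩
  have heq := congrArg (Ideal.map (algebraMap B (LocalizedAlgebra B M))) huniq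
  rw [IsLocalization.map_under (Algebra.algebraMapSubmonoid B M.primeCompl),
    IsLocalization.map_under (Algebra.algebraMapSubmonoid B M.primeCompl)] at heq
  exact hf (heq ▸ hfm)

theorem ringKrullDim_eq_one (hB : ¬ IsField B)
    (h : ∀ Q : Ideal B, Q ≠ ⊥ → Q.IsPrime → Q.IsMaximal) : ringKrullDim B = 1 := by
  have h1 : ringKrullDim B ≤ 1 :=
    Ring.krullDimLE_iff.1 (Ring.krullDimLE_one_iff_of_noZeroDivisors.2 h)
  refine h1.antisymm ?_
  by_contra hlt
  have h0 : Ring.KrullDimLE 0 B := Ring.krullDimLE_iff.2 (by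
    rw [not_le] at hlt
    exact ENat.WithBot.lt_add_one_iff.1 (by simpa using hlt))
  exact hB Ring.KrullDimLE.isField_of_isDomain

theorem HasConductor.isMaximal_of_localized_isDiscreteValuationRing (h : HasConductor R B)
    (hACC : ColonACC R) (hDVR : ∀ (M : Ideal R) [M.IsMaximal] [IsDomain (LocalizedAlgebra B M)],
      IsDiscreteValuationRing (LocalizedAlgebra B M)) {P : Ideal R} (hP0 : P ≠ ⊥)
    (hP : P.IsPrime) : P.IsMaximal := by
  obtain ⟨M, hM, hPM⟩ := P.exists_le_maximal hP.ne_top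
  have := h.isDomain_localizedAlgebra M
  have := hDVR M
  have hinj : Function.Injective (algebraMap R (Localization.AtPrime M)) :=
    IsLocalization.injective _ M.primeCompl_le_nonZeroDivisors
  have hdisj : Disjoint (M.primeCompl : Set R) (P : Set R) :=
    Set.disjoint_left.2 fun s hs hsP => hs (hPM hsP)
  have hP' := IsLocalization.isPrime_of_isPrime_disjoint M.primeCompl (Localization.AtPrime M) P
    hP hdisj
  have hne : P.map (algebraMap R (Localization.AtPrime M)) ≠ ⊥ := by
    rwa [Ne, Ideal.map_eq_bot_iff_of_injective hinj]
  have heq := (h.localization M).eq_maximalIdeal (hACC.localization M.primeCompl) hP' hne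
  rw [← IsLocalization.under_map_of_isPrime_disjoint M.primeCompl (Localization.AtPrime M) hP
    hdisj, heq]
  have : (maximalIdeal (Localization.AtPrime M)).under R = M :=
    Localization.AtPrime.under_maximalIdeal
  rwa [this]

theorem HasConductor.isUnibranched_of_localized (h : HasConductor R B) (hACC : ColonACC R)
    (hR : ¬ IsField R) (hDVR : ∀ (M : Ideal R) [M.IsMaximal] [IsDomain (LocalizedAlgebra B M)],
      IsDiscreteValuationRing (LocalizedAlgebra B M)) :
    IsUnibranched R B ∧ ringKrullDim R = 1 ∧ ringKrullDim B = 1 := by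
  have hmax := fun {P : Ideal R} => h.isMaximal_of_localized_isDiscreteValuationRing hACC hDVR
    (P := P)
  have hbot : ∀ Q : Ideal B, Q.comap (algebraMap R B) = ⊥ → Q = ⊥ := by
    intro Q hQ
    by_contra hQ0
    obtain ⟨q, hq, hq0⟩ := Submodule.exists_mem_ne_zero_of_ne_bot hQ0
    obtain ⟨c, hc0, hcB⟩ := h.exists_conductor
    obtain ⟨r, hr⟩ := hcB q
    have hrQ : r ∈ Q.comap (algebraMap R B) := by
      rw [Ideal.mem_comap, hr]
      exact Q.mul_mem_left _ hq
    rw [hQ, Ideal.mem_bot] at hrQ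
    rw [hrQ, map_zero] at hr
    refine mul_ne_zero ?_ hq0 hr.symm
    rwa [Ne, map_eq_zero_iff _ h.inj]
  have huni : IsUnibranched R B := by
    intro P hP
    by_cases hP0 : P = ⊥
    · subst hP0
      exact ⟨⊥, ⟨Ideal.isPrime_bot, Ideal.comap_bot_of_injective _ h.inj⟩,
        fun Q hQ => hbot Q hQ.2⟩
    · have := hmax hP0 hP
      have := h.isDomain_localizedAlgebra P
      have := hDVR P
      exact h.existsUnique_prime_over hACC hP0
  refine ⟨huni, ringKrullDim_eq_one hR fun P hP0 hP => hmax hP0 hP, ?_⟩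
  refine ringKrullDim_eq_one (fun hB => ?_) fun Q hQ0 hQ => ?_
  · obtain ⟨M, hM⟩ := Ideal.exists_maximal R
    have hM0 := Ring.ne_bot_of_isMaximal_of_not_isField hM hR
    obtain ⟨x, hxM, hx⟩ := Submodule.exists_mem_ne_zero_of_ne_bot hM0
    refine h.not_isUnit_algebraMap hACC (t := x)
      (fun hu => hM.ne_top (Ideal.eq_top_of_isUnit_mem _ hxM hu)) ?_
    obtain ⟨y, hy⟩ := hB.mul_inv_cancel (a := algebraMap R B x)
      (by rwa [Ne, map_eq_zero_iff _ h.inj])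
    exact IsUnit.of_mul_eq_one y hy
  · have hM := hmax (fun h0 => hQ0 (hbot Q h0)) (hQ.comap (algebraMap R B))
    obtain ⟨N, hN, hQN⟩ := Q.exists_le_maximal hQ.ne_top
    have hcomap : Q.comap (algebraMap R B) = N.comap (algebraMap R B) :=
      hM.eq_of_le (hN.isPrime.comap (algebraMap R B)).ne_top (Ideal.comap_mono hQN)
    rwa [(huni _ hM.isPrime).unique ⟨hQ, rfl⟩ ⟨hN.isPrime, hcomap.symm⟩]

end Global

/-! ### Gluing local factorizations -/

section Factorization

open IsLocalRing

variable {R B : Type*} [CommRing R] [CommRing B] [Algebra R B]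

theorem map_eq_top_of_not_le {M I : Ideal R} [M.IsPrime] (hI : ¬ I ≤ M) :
    I.map (algebraMap R (Localization.AtPrime M)) = ⊤ := by
  obtain ⟨x, hxI, hxM⟩ := Set.not_subset.1 hI
  exact Ideal.eq_top_of_isUnit_mem _ (Ideal.mem_map_of_mem _ hxI)
    (IsLocalization.map_units (Localization.AtPrime M) (⟨x, hxM⟩ : M.primeCompl))

/-- Contracted factors contain a power of `M`, so they become trivial at the other maximal ideals
and do not disturb them. -/
theorem exists_factorization_of_localization {M I : Ideal R} [hM : M.IsMaximal] {m N : ℕ}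
    (hmN : m ≤ N)
    (h : ∃ s : Multiset (Ideal (Localization.AtPrime M)),
      (∀ J ∈ s, maximalIdeal (Localization.AtPrime M) ^ m ≤ J) ∧
        s.prod = I.map (algebraMap R (Localization.AtPrime M))) :
    ∃ s : Multiset (Ideal R), (∀ J ∈ s, IsNAbsorbing N J ∧ M ^ N ≤ J) ∧
      s.prod.map (algebraMap R (Localization.AtPrime M)) =
        I.map (algebraMap R (Localization.AtPrime M)) := by
  obtain ⟨s, hs, hsI⟩ := h
  refine ⟨s.map (fun J => J.under R), ?_, ?_⟩
  · intro J hJ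
    obtain ⟨J, hJs, rfl⟩ := Multiset.mem_map.1 hJ
    have hle := (Ideal.pow_le_pow_right hmN).trans (hs J hJs)
    refine ⟨(isNAbsorbing_of_pow_le hle).comap _, ?_⟩
    rw [Ideal.under_def, ← Ideal.map_le_iff_le_comap, Ideal.map_pow]
    refine (Ideal.pow_right_mono ?_ N).trans hle
    rw [Ideal.map_le_iff_le_comap]
    exact fun r hr => (IsLocalization.AtPrime.to_map_mem_maximal_iff _ M r).2 hr
  · rw [← hsI]
    have h1 := map_multiset_prod (Ideal.mapHom (algebraMap R (Localization.AtPrime M)))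
      (s.map (fun J => J.under R))
    refine h1.trans ?_
    rw [Multiset.map_map]
    congr 1
    conv_rhs => rw [← Multiset.map_id s]
    exact Multiset.map_congr rfl fun J _ => IsLocalization.map_under M.primeCompl _ J

variable [IsDomain R] [IsDomain B]

/-- In `R_M` the only nonzero prime is the maximal ideal, so it is the associated prime of `x`.
Finiteness of these primes bounds the maximal ideals containing `x`. -/
theorem HasConductor.mem_maximalColons (h : HasConductor R B) (hACC : ColonACC R) {M : Ideal R}
    [hM : M.IsMaximal] [IsDomain (LocalizedAlgebra B M)]
    [IsDiscreteValuationRing (LocalizedAlgebra B M)] {x : R} (hx : x ≠ 0) (hxM : x ∈ M) :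
    M ∈ maximalColons x := by
  have hACCM := hACC.localization (A := Localization.AtPrime M) M.primeCompl
  have hx0 : algebraMap R (Localization.AtPrime M) x ≠ 0 := by
    rwa [Ne, map_eq_zero_iff _
      (IsLocalization.injective (Localization.AtPrime M) M.primeCompl_le_nonZeroDivisors)]
  have hxu : ¬ algebraMap R (Localization.AtPrime M) x ∣ 1 := fun h1 => (mem_maximalIdeal _).1
    ((IsLocalization.AtPrime.to_map_mem_maximal_iff _ M x).2 hxM) (isUnit_of_dvd_one h1)
  obtain ⟨z', -, -, hp⟩ := exists_prime_colon hACCM hx0 hxu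
  obtain ⟨z, hz⟩ := hACC.exists_eq_dvdColon hx ⟨z', ((h.localization M).eq_maximalIdeal hACCM hp
    (fun h0 => hx0 ((Submodule.eq_bot_iff _).1 h0 _ (self_mem_dvdColon _ _)))).symm⟩
  have hne : ∀ w, ¬ x ∣ w → dvdColon x {w} ≠ ⊤ := fun w hw h1 => by
    rw [Ideal.eq_top_iff_one, mem_dvdColon_singleton, one_mul] at h1
    exact hw h1
  refine ⟨z, fun hdvd => hM.ne_top ?_, hz, fun w hw hle => (hM.eq_of_le (hne w hw) hle).ge⟩
  rw [hz, Ideal.eq_top_iff_one, mem_dvdColon_singleton, one_mul]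
  exact hdvd

theorem HasConductor.finite_maximalIdeals (h : HasConductor R B) (hACC : ColonACC R)
    (hDVR : ∀ (M : Ideal R) [M.IsMaximal] [IsDomain (LocalizedAlgebra B M)],
      IsDiscreteValuationRing (LocalizedAlgebra B M)) {x : R} (hx : x ≠ 0) :
    {M : {M : Ideal R // M.IsMaximal} | x ∈ M.1}.Finite := by
  refine Set.Finite.subset
    ((hACC.finite_maximalColons hx).preimage Subtype.val_injective.injOn) ?_
  rintro ⟨M, hM⟩ hxM
  have := h.isDomain_localizedAlgebra M
  have := hDVR M
  exact h.mem_maximalColons hACC hx hxM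

theorem isNAbsorbing_bot {n : ℕ} (hn : 0 < n) : IsNAbsorbing n (⊥ : Ideal R) := by
  intro a ha
  rw [Ideal.mem_bot, Finset.prod_eq_zero_iff] at ha
  obtain ⟨i, -, hi⟩ := ha
  have : Nontrivial (Fin (n + 1)) := Fin.nontrivial_iff_two_le.2 (by omega)
  obtain ⟨j, hj⟩ := exists_ne i
  exact ⟨j, by
    rw [Ideal.mem_bot]
    exact Finset.prod_eq_zero (Finset.mem_erase.2 ⟨hj.symm, Finset.mem_univ i⟩) hi⟩

theorem HasConductor.isFAFDomain_of_localized (h : HasConductor R B) (hACC : ColonACC R)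
    (hR : ¬ IsField R) (hDVR : ∀ (M : Ideal R) [M.IsMaximal] [IsDomain (LocalizedAlgebra B M)],
      IsDiscreteValuationRing (LocalizedAlgebra B M)) : IsFAFDomain R := by
  classical
  obtain ⟨c, hc0, hcB⟩ := h.exists_conductor
  have hloc : ∀ M : {M : Ideal R // M.IsMaximal}, ∃ n, (c ∉ M.1 → n = 1) ∧
      ∀ (_ : M.1.IsMaximal) (I : Ideal (Localization.AtPrime M.1)), I ≠ ⊥ →
        ∃ s : Multiset (Ideal (Localization.AtPrime M.1)),
          (∀ J ∈ s, maximalIdeal (Localization.AtPrime M.1) ^ n ≤ J) ∧ s.prod = I := by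
    rintro ⟨M, hM⟩
    have := h.isDomain_localizedAlgebra M
    have := hDVR M
    have hinj : Function.Injective (algebraMap R (Localization.AtPrime M)) :=
      IsLocalization.injective _ M.primeCompl_le_nonZeroDivisors
    obtain ⟨n, hn, hfac⟩ := (h.localization M).exists_uniform_factorization
      (hACC.localization M.primeCompl)
      (not_isField_localization M (Ring.ne_bot_of_isMaximal_of_not_isField hM hR))
      (c := algebraMap R _ c) (by rwa [Ne, map_eq_zero_iff _ hinj]) (h.localization_of_mem M hcB)
    exact ⟨n, fun hcM => hn (IsLocalization.map_units (Localization.AtPrime M)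
      (⟨c, hcM⟩ : M.primeCompl)), fun _ => hfac⟩
  choose n hn hfac using hloc
  let F := (h.finite_maximalIdeals hACC hDVR hc0).toFinset
  -- The summand `1` covers the maximal ideals not containing `c`, where `n M = 1`, and keeps `N`
  -- positive for the zero ideal.
  let N := 1 + ∑ M ∈ F, n M
  have hnN : ∀ M, n M ≤ N := by
    intro M
    by_cases hM : M ∈ F
    · exact (Finset.single_le_sum (fun _ _ => Nat.zero_le _) hM).trans (Nat.le_add_left _ _)
    · rw [hn M fun h1 => hM (by simpa [F] using h1)]
      exact Nat.le_add_right _ _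
  refine isFAFDomain_iff.2 ⟨inferInstance, N, by omega, fun I hI => ?_⟩
  by_cases hI0 : I = ⊥
  · exact ⟨{⊥}, fun J hJ => by
      rw [Multiset.mem_singleton.1 hJ]; exact isNAbsorbing_bot (by omega), by simp [hI0]⟩
  have hex : ∀ M : {M : Ideal R // M.IsMaximal}, ∃ s : Multiset (Ideal R),
      (∀ J ∈ s, IsNAbsorbing N J ∧ M.1 ^ N ≤ J) ∧ ∀ _ : M.1.IsMaximal,
        s.prod.map (algebraMap R (Localization.AtPrime M.1)) =
          I.map (algebraMap R (Localization.AtPrime M.1)) := by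
    intro M
    have hM := M.2
    have hinj : Function.Injective (algebraMap R (Localization.AtPrime M.1)) :=
      IsLocalization.injective _ M.1.primeCompl_le_nonZeroDivisors
    obtain ⟨s, hs, hsI⟩ := exists_factorization_of_localization (hnN M)
      (hfac M hM (I.map (algebraMap R _)) (by
        rwa [Ne, Ideal.map_eq_bot_iff_of_injective hinj]))
    exact ⟨s, hs, fun _ => hsI⟩
  choose s hs hsI using hex
  have hfin : {M : {M : Ideal R // M.IsMaximal} | I ≤ M.1}.Finite := by
    obtain ⟨x, hxI, hx⟩ := Submodule.exists_mem_ne_zero_of_ne_bot hI0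
    exact (h.finite_maximalIdeals hACC hDVR hx).subset fun M hM => hM hxI
  refine ⟨∑ M ∈ hfin.toFinset, s M, fun J hJ => ?_, ?_⟩
  · obtain ⟨M, -, hM⟩ := Multiset.mem_sum.1 hJ
    exact (hs M J hM).1
  · refine Ideal.eq_of_localization_maximal fun M hM => ?_
    rw [Multiset.prod_sum]
    refine (map_prod (Ideal.mapHom (algebraMap R (Localization.AtPrime M))) _ _).trans ?_
    simp only [Ideal.mapHom_apply]
    have hne : ∀ M' : {M : Ideal R // M.IsMaximal}, M' ≠ ⟨M, hM⟩ →
        (s M').prod.map (algebraMap R (Localization.AtPrime M)) = 1 := by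
      intro M' hM'
      rw [Ideal.one_eq_top]
      refine map_eq_top_of_not_le fun hle => hM' (Subtype.ext ?_)
      have h1 := (pow_card_le_multiset_prod fun J hJ => (hs M' J hJ).2).trans hle
      rw [← pow_mul] at h1
      exact M'.2.eq_of_le hM.ne_top (hM.isPrime.le_of_pow_le h1)
    by_cases hIM : I ≤ M
    · rw [Finset.prod_eq_single ⟨M, hM⟩ (fun M' _ hM' => hne M' hM')
        (fun h1 => (h1 (by simpa using hIM)).elim)]
      exact hsI ⟨M, hM⟩ hM
    · rw [map_eq_top_of_not_le hIM, ← Ideal.one_eq_top]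
      refine Finset.prod_eq_one fun M' hM' => hne M' ?_
      rintro rfl
      exact hIM (by simpa using hM')

end Factorization

/-! ### The equivalence -/

theorem theorem4p5 {R K : Type*} [CommRing R] [IsDomain R] [Field K] [Algebra R K]
    [IsFractionRing R K]
    (hfield : ¬ IsField R)
    (hMori : IsMoriDomain R K)
    (hcond : (1 : Submodule R K) / Subalgebra.toSubmodule (completeIntegralClosure R K) ≠ ⊥) :
    List.TFAE [
      IsFAFDomain R,
      ∀ (M : Ideal R) [M.IsMaximal], IsFAFDomain (Localization.AtPrime M),
      IsUnibranched R (completeIntegralClosure R K) ∧ ringKrullDim R = 1 ∧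
        ringKrullDim (completeIntegralClosure R K) = 1,
      IsLocallyConducive R] := by
  have hACC := hMori.colonACC R K
  have h := completeIntegralClosure.hasConductor R K hcond
  have hB := completeIntegralClosure.powDvdClosed R K h
  have hbot : ∀ (M : Ideal R) [M.IsMaximal], M ≠ ⊥ := fun M hM =>
    Ring.ne_bot_of_isMaximal_of_not_isField hM hfield
  tfae_have 1 → 2 := by
    intro hFAF M _
    obtain ⟨-, n, hn, hfac⟩ := isFAFDomain_iff.1 hFAF
    exact isFAFDomain_iff.2 ⟨inferInstance, n, hn, hfac.localization M.primeCompl⟩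
  tfae_have 2 → 3 := fun hFAF => h.isUnibranched_of_localized hACC hfield fun M _ _ =>
    h.localized_isDiscreteValuationRing_of_isFAFDomain hACC hB (hbot M) (hFAF M)
  tfae_have 3 → 4 := by
    rintro ⟨huni, hdim, -⟩ M _
    have := h.isDomain_localizedAlgebra M
    exact (h.isConducive_localization_iff hACC hB (hbot M)).2
      (h.localized_isDiscreteValuationRing_of_isUnibranched hACC hB
        (Ring.krullDimLE_iff.2 hdim.le) huni (hbot M))
  tfae_have 4 → 1 := fun hcon => h.isFAFDomain_of_localized hACC hfield fun M _ _ =>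
    (h.isConducive_localization_iff hACC hB (hbot M)).1 (hcon M)
  tfae_finish
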